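/- For a real analytic function germ $f:(\mathbb{R}^d,0)\to(\mathbb{R},0)$ and $n\ge 1$, let $\mathcal{L}_n$ be the space of truncated arcs $\gamma(t)=a_1t+\dots+a_nt^n$, $a_i\in\mathbb{R}^d$ (identified with $\mathbb{R}^{nd}$), let $$\mathcal{X}_{n,+}(f)=\{\gamma\in\mathcal{L}_n : f(\gamma(t))=ct^n+\cdots,\ c>0\},\qquad \mathcal{X}_{n,-}(f)=\{\gamma\in\mathcal{L}_n : f(\gamma(t))=ct^n+\cdots,\ c<0\},$$ and define the positive and negative zeta functions of $f$ by $$Z_{f,\pm}(T)=\sum_{n\ge1}(-1)^{-nd}\,\chi^c(\mathcal{X}_{n,\pm}(f))\,T^n\in\mathbb{Z}[[T]],$$ where $\chi^c$ is the Euler characteristic with compact supports (for a semialgebraic set: the sum of $(-1)^{\dim C}$ over the cells $C$ of any finite partition into cells). The total zeta function is $Z_f=Z_{f,+}+Z_{f,-}$. Write $(f*g)(x,y)=f(x)+g(y)$. Proposition. Let $f(x_1,\dots,x_d)=\pm x_1^{m_1}\pm\cdots\pm x_d^{m_d}$ be a Brieskorn polynomial with all $m_i\ge2$, and let $g(y)=\pm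 y^r$ with $r\ge1$. Then $r$ is determined by the zeta functions of $f$ and of $f*g$. If, moreover, $r$ is even and is not a multiple of any odd $m_i$, then the sign of $y^r$ is determined by them, too. Precisely: let $f_1(x_1,\dots,x_{d_1})=\sum_i\varepsilon_{1,i}x_i^{m_{1,i}}$ and $f_2(x_1,\dots,x_{d_2})=\sum_i\varepsilon_{2,i}x_i^{m_{2,i}}$ with signs $\varepsilon_{j,i}=\pm1$ and all exponents $m_{j,i}\ge2$ (the numbers of variables may differ), and let $g_1(y)=\delta_1y^{r_1}$, $g_2(y)=\delta_2y^{r_2}$ with $\delta_j=\pm1$, $r_j\ge1$. Suppose that $Z_{f_1,+}=Z_{f_2,+}$, $Z_{f_1,-}=Z_{f_2,-}$, $Z_{f_1*g_1,+}=Z_{f_2*g_2,+}$ and $Z_{f_1*g_1,-}=Z_{f_2*g_2,-}$. Then $r_1=r_2$; and if $r_1$ is even and not divisible by any odd exponent $m_{1,i}$ of $f_1$, then $\delta_1=\delta_2$. -/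

import Mathlib

open Filter Topology Asymptotics

/-! ### Cells and the Euler characteristic with compact supports -/

/-- `IsCell N k C`: the set `C ⊆ ℝ^N` is a `k`-dimensional (cylindrical) cell. The only cell of `ℝ^0`
is the point; a cell of `ℝ^(N+1)` is either the graph of a continuous function over a cell of `ℝ^N`,
or the open band between two continuous functions `φ < ψ` over a cell of `ℝ^N`, where the values
`-∞` for `φ` and `+∞` for `ψ` are allowed. A `k`-dimensional cell is homeomorphic to `ℝ^k`. -/
inductive IsCell : (N : ℕ) → ℕ → Set (Fin N → ℝ) → Prop
  | point : IsCell 0 0 Set.univ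
  | graph {N k : ℕ} {C : Set (Fin N → ℝ)} (hC : IsCell N k C)
      (φ : (Fin N → ℝ) → ℝ) (hφ : ContinuousOn φ C) :
      IsCell (N + 1) k {x | Fin.init x ∈ C ∧ x (Fin.last N) = φ (Fin.init x)}
  | band {N k : ℕ} {C : Set (Fin N → ℝ)} (hC : IsCell N k C)
      (φ ψ : (Fin N → ℝ) → EReal) (hφ : ContinuousOn φ C) (hψ : ContinuousOn ψ C)
      (hlt : ∀ x ∈ C, φ x < ψ x) :
      IsCell (N + 1) (k + 1)
        {x | Fin.init x ∈ C ∧ φ (Fin.init x) < (x (Fin.last N) : EReal) ∧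
          (x (Fin.last N) : EReal) < ψ (Fin.init x)}

/-- `HasEulerChar A c`: the set `A ⊆ ℝ^N` is a disjoint union of finitely many cells, and `c` is the
sum of `(-1)^(dim C)` over these cells `C`. Every semialgebraic set admits such a partition. -/
def HasEulerChar {N : ℕ} (A : Set (Fin N → ℝ)) (c : ℤ) : Prop :=
  ∃ (s : ℕ) (C : Fin s → Set (Fin N → ℝ)) (k : Fin s → ℕ),
    (∀ j, IsCell N (k j) (C j)) ∧ Pairwise (fun i j => Disjoint (C i) (C j)) ∧
      (⋃ j, C j) = A ∧ c = ∑ j, (-1) ^ k j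

open Classical in
/-- The Euler characteristic with compact supports `χ^c(A)` of a set `A ⊆ ℝ^N` that has a finite
partition into cells, in particular of any semialgebraic set; by `HasEulerChar.unique` below it does
not depend on the partition. (Junk value `0` if there is no such partition.) -/
noncomputable def eulerCharC {N : ℕ} (A : Set (Fin N → ℝ)) : ℤ :=
  if h : ∃ c, HasEulerChar A c then h.choose else 0

/-! #### Independence of the partition -/

/-- Each real `p` has a point to its right before the next element of a finite set. -/
theorem exists_right_sample (S : Finset ℝ) (p : ℝ) :
    ∃ t, p < t ∧ ∀ q ∈ S, p < q → t < q := by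
  classical
  by_cases h : (S.filter (fun q => p < q)).Nonempty
  · have hm := (S.filter (fun q => p < q)).min'_mem h
    rw [Finset.mem_filter] at hm
    obtain ⟨t, h1, h2⟩ := exists_between hm.2
    refine ⟨t, h1, fun q hq hpq => lt_of_lt_of_le h2 ?_⟩
    exact Finset.min'_le _ _ (Finset.mem_filter.2 ⟨hq, hpq⟩)
  · refine ⟨p + 1, by linarith, fun q hq hpq => ?_⟩
    exact absurd ⟨q, Finset.mem_filter.2 ⟨hq, hpq⟩⟩ h

open Classical in
/-- Points count `1` and open intervals count `-1`, for a functional that only evaluates at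
finitely many places. -/
theorem line_functional (S : Finset ℝ) (t : ℝ → ℝ) (u : ℝ)
    (ht : ∀ p, p < t p ∧ ∀ q ∈ S, p < q → t p < q) (hu : ∀ q ∈ S, u < q) :
    (∀ a ∈ S, (∑ p ∈ S, ((if p = a then (1 : ℤ) else 0) - (if t p = a then 1 else 0)))
        - (if u = a then 1 else 0) = 1) ∧
    (∀ a b : EReal, a < b → (∀ x : ℝ, (x : EReal) = a → x ∈ S) →
      (∀ x : ℝ, (x : EReal) = b → x ∈ S) →
      (∑ p ∈ S, ((if a < (p : EReal) ∧ (p : EReal) < b then (1 : ℤ) else 0)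
          - (if a < (t p : EReal) ∧ (t p : EReal) < b then 1 else 0)))
        - (if a < (u : EReal) ∧ (u : EReal) < b then 1 else 0) = -1) := by
  constructor
  · intro a ha
    have h1 : ∀ p ∈ S, (if t p = a then (1 : ℤ) else 0) = 0 := by
      intro p _
      rw [if_neg]
      intro h
      have h2 := (ht p).1
      have h3 := (ht p).2 a ha
      rw [h] at h2 h3
      exact lt_irrefl _ (h3 h2)
    have h2 : (if u = a then (1 : ℤ) else 0) = 0 := if_neg (ne_of_lt (hu a ha))
    rw [h2, Finset.sum_sub_distrib, Finset.sum_eq_zero h1, Finset.sum_ite_eq_of_mem' _ _ _ ha]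
    norm_num
  · intro a b hab hxa hxb
    have key : ∀ p ∈ S, (a < (t p : EReal) ∧ (t p : EReal) < b) ↔
        (a ≤ (p : EReal) ∧ (p : EReal) < b) := by
      intro p hp
      obtain ⟨h1, h2⟩ := ht p
      constructor
      · rintro ⟨h3, h4⟩
        refine ⟨?_, lt_trans (EReal.coe_lt_coe_iff.2 h1) h4⟩
        by_contra h5
        rw [not_le] at h5
        induction a with
        | bot => exact not_lt_bot h5
        | top => exact not_top_lt h3
        | coe x =>
          rw [EReal.coe_lt_coe_iff] at h5 h3
          exact lt_asymm h3 (h2 x (hxa x rfl) h5)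
      · rintro ⟨h3, h4⟩
        refine ⟨lt_of_le_of_lt h3 (EReal.coe_lt_coe_iff.2 h1), ?_⟩
        induction b with
        | bot => exact absurd h4 not_lt_bot
        | top => exact EReal.coe_lt_top _
        | coe x =>
          rw [EReal.coe_lt_coe_iff] at h4 ⊢
          exact h2 x (hxb x rfl) h4
    have h1 : ∀ p ∈ S, ((if a < (p : EReal) ∧ (p : EReal) < b then (1 : ℤ) else 0)
          - (if a < (t p : EReal) ∧ (t p : EReal) < b then 1 else 0))
          = if (p : EReal) = a then -1 else 0 := by
      intro p hp
      rw [if_congr (key p hp) rfl rfl]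
      by_cases h : (p : EReal) = a
      · simp [h, hab]
      · have : a ≤ (p : EReal) ↔ a < (p : EReal) :=
          ⟨fun h' => lt_of_le_of_ne h' (Ne.symm h), le_of_lt⟩
        simp [h, this]
    rw [Finset.sum_congr rfl h1]
    induction a with
    | top => exact absurd hab not_top_lt
    | bot =>
      have h2 : (u : EReal) < b := by
        induction b with
        | bot => exact absurd hab not_lt_bot
        | top => exact EReal.coe_lt_top _
        | coe x => exact EReal.coe_lt_coe_iff.2 (hu x (hxb x rfl))
      simp [h2, EReal.bot_lt_coe]
    | coe x =>
      have h2 := hu x (hxa x rfl)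
      have h3 : ¬ ((x : EReal) < (u : EReal)) := by
        rw [EReal.coe_lt_coe_iff]; exact not_lt.2 h2.le
      simp [h3, hxa x rfl]

open Classical in
/-- A vanishing integer combination of indicators of points (`e = 1`), open intervals (`e = -1`) and
empty sets (`e = 0`) of the real line has vanishing Euler characteristic. -/
theorem line_relation {s : ℕ} (a : Fin s → ℤ) (F : Fin s → Set ℝ) (e : Fin s → ℤ)
    (hF : ∀ j, (F j = ∅ ∧ e j = 0) ∨ (∃ y : ℝ, F j = {y} ∧ e j = 1) ∨
      (∃ b c : EReal, b < c ∧ F j = {y : ℝ | b < (y : EReal) ∧ (y : EReal) < c} ∧ e j = -1))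
    (h0 : ∀ y, ∑ j, a j * (if y ∈ F j then 1 else 0) = 0) : ∑ j, a j * e j = 0 := by
  have hS : ∃ S : Finset ℝ, ∀ j, (F j = ∅ ∧ e j = 0) ∨ (∃ y ∈ S, F j = {y} ∧ e j = 1) ∨
      (∃ b c : EReal, b < c ∧ (∀ x : ℝ, (x : EReal) = b → x ∈ S) ∧
        (∀ x : ℝ, (x : EReal) = c → x ∈ S) ∧
        F j = {y : ℝ | b < (y : EReal) ∧ (y : EReal) < c} ∧ e j = -1) := by
    have : ∀ j, ∃ S : Finset ℝ, (F j = ∅ ∧ e j = 0) ∨ (∃ y ∈ S, F j = {y} ∧ e j = 1) ∨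
      (∃ b c : EReal, b < c ∧ (∀ x : ℝ, (x : EReal) = b → x ∈ S) ∧
        (∀ x : ℝ, (x : EReal) = c → x ∈ S) ∧
        F j = {y : ℝ | b < (y : EReal) ∧ (y : EReal) < c} ∧ e j = -1) := by
      intro j
      rcases hF j with h | ⟨y, h⟩ | ⟨b, c, hbc, h⟩
      · exact ⟨∅, Or.inl h⟩
      · exact ⟨{y}, Or.inr (Or.inl ⟨y, by simp, h⟩)⟩
      · refine ⟨{b.toReal, c.toReal}, Or.inr (Or.inr ⟨b, c, hbc, ?_, ?_, h⟩)⟩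
        · rintro x rfl; simp
        · rintro x rfl; simp
    choose S hS using this
    refine ⟨Finset.univ.biUnion S, fun j => ?_⟩
    have hsub : ∀ x ∈ S j, x ∈ Finset.univ.biUnion S :=
      fun x hx => Finset.mem_biUnion.2 ⟨j, Finset.mem_univ _, hx⟩
    rcases hS j with h | ⟨y, hy, h⟩ | ⟨b, c, hbc, hb, hc, h⟩
    · exact Or.inl h
    · exact Or.inr (Or.inl ⟨y, hsub y hy, h⟩)
    · exact Or.inr (Or.inr ⟨b, c, hbc, fun x hx => hsub x (hb x hx),
        fun x hx => hsub x (hc x hx), h⟩)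
  obtain ⟨S, hS⟩ := hS
  choose t ht using exists_right_sample S
  obtain ⟨u, hu⟩ : ∃ u, ∀ q ∈ S, u < q := by
    obtain ⟨b, hb⟩ := S.bddBelow
    exact ⟨b - 1, fun q hq => by have := hb hq; linarith⟩
  obtain ⟨L1, L2⟩ := line_functional S t u ht hu
  have hL : ∀ j, (∑ p ∈ S, ((if p ∈ F j then (1 : ℤ) else 0) - (if t p ∈ F j then 1 else 0)))
      - (if u ∈ F j then 1 else 0) = e j := by
    intro j
    rcases hS j with ⟨h, he⟩ | ⟨y, hy, h, he⟩ | ⟨b, c, hbc, hb, hc, h, he⟩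
    · simp [h, he]
    · rw [h, he]; exact L1 y hy
    · rw [h, he]
      simp only [Set.mem_ofPred_eq]
      convert L2 b c hbc hb hc
  have h1 : ∑ j, a j * e j = (∑ p ∈ S, ((∑ j, a j * (if p ∈ F j then 1 else 0))
      - (∑ j, a j * (if t p ∈ F j then 1 else 0)))) - ∑ j, a j * (if u ∈ F j then 1 else 0) := by
    simp_rw [← hL, mul_sub, Finset.sum_sub_distrib, mul_sub, Finset.mul_sum,
      Finset.sum_sub_distrib]
    rw [Finset.sum_comm, Finset.sum_comm (s := S) (t := Finset.univ)]
    congr 2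
    exact Finset.sum_comm
  rw [h1]
  simp only [h0, sub_self, Finset.sum_const_zero]

open Classical in
/-- A vanishing integer combination of indicators of cells has vanishing Euler characteristic. -/
theorem cell_relation (N : ℕ) : ∀ {s : ℕ} (a : Fin s → ℤ) (C : Fin s → Set (Fin N → ℝ))
    (k : Fin s → ℕ), (∀ j, IsCell N (k j) (C j)) →
    (∀ x, ∑ j, a j * (if x ∈ C j then 1 else 0) = 0) → ∑ j, a j * (-1) ^ k j = 0 := by
  induction N with
  | zero =>
    intro s a C k hC h0
    have h1 : ∀ j, C j = Set.univ ∧ k j = 0 := by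
      intro j
      have := hC j
      generalize C j = D at this
      generalize k j = l at this
      cases this
      exact ⟨rfl, rfl⟩
    simpa [h1] using h0 0
  | succ N ih =>
    intro s a C k hC h0
    have h1 : ∀ j, ∃ (D : Set (Fin N → ℝ)) (l : ℕ) (e : ℤ), IsCell N l D ∧
        (-1) ^ k j = e * (-1) ^ l ∧ (∀ x ∉ D, {y : ℝ | Fin.snoc x y ∈ C j} = ∅) ∧
        ∀ x ∈ D, (∃ y : ℝ, {y : ℝ | Fin.snoc x y ∈ C j} = {y} ∧ e = 1) ∨
          (∃ b c : EReal, b < c ∧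
            {y : ℝ | Fin.snoc x y ∈ C j} = {y : ℝ | b < (y : EReal) ∧ (y : EReal) < c} ∧
            e = -1) := by
      intro j
      have := hC j
      generalize C j = E at this
      generalize k j = l at this
      cases this with
      | @graph _ _ D hD φ hφ =>
        refine ⟨D, l, 1, hD, by ring, fun x hx => ?_, fun x hx => Or.inl ⟨φ x, ?_, rfl⟩⟩
        · ext y; simp [hx]
        · ext y; simp [hx]
      | @band _ l' D hD φ ψ hφ hψ hlt =>
        refine ⟨D, l', -1, hD, by ring, fun x hx => ?_,
          fun x hx => Or.inr ⟨φ x, ψ x, hlt x hx, ?_, rfl⟩⟩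
        · ext y; simp [hx]
        · ext y; simp [hx]
    choose D l e hD hsign hout hin using h1
    have h2 : ∑ j, (a j * e j) * (-1) ^ l j = 0 := by
      refine ih (fun j => a j * e j) D l hD fun x => ?_
      have := line_relation a (fun j => {y : ℝ | Fin.snoc x y ∈ C j})
        (fun j => e j * (if x ∈ D j then 1 else 0)) (fun j => ?_) (fun y => ?_)
      · simpa only [mul_assoc] using this
      · by_cases hx : x ∈ D j
        · right; simpa [hx] using hin j x hx
        · left; simpa [hx] using hout j x hx
      · exact h0 (Fin.snoc x y)
    rw [← h2]
    exact Finset.sum_congr rfl fun j _ => by rw [hsign, mul_assoc]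

/-- The alternating sum over a partition into cells does not depend on the partition. -/
theorem HasEulerChar.unique {N : ℕ} {A : Set (Fin N → ℝ)} {c c' : ℤ}
    (h : HasEulerChar A c) (h' : HasEulerChar A c') : c = c' := by
  classical
  obtain ⟨s, C, k, hC, hd, hA, rfl⟩ := h
  obtain ⟨s', C', k', hC', hd', hA', rfl⟩ := h'
  have ind : ∀ {n : ℕ} (E : Fin n → Set (Fin N → ℝ)),
      Pairwise (fun i j => Disjoint (E i) (E j)) → (⋃ j, E j) = A →
      ∀ x, (∑ j, if x ∈ E j then (1 : ℤ) else 0) = if x ∈ A then 1 else 0 := by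
    intro n E hE hEA x
    by_cases hx : x ∈ A
    · have hx' := hx
      rw [← hEA, Set.mem_iUnion] at hx'
      obtain ⟨i, hi⟩ := hx'
      rw [Finset.sum_eq_single i]
      · simp [hi, hx]
      · intro j _ hji
        exact if_neg fun hj => Set.disjoint_left.1 (hE hji) hj hi
      · simp
    · have : ∀ j, x ∉ E j := fun j hj => hx (hEA ▸ Set.mem_iUnion.2 ⟨j, hj⟩)
      simp [hx, this]
  have := cell_relation N (Fin.append (fun _ : Fin s => (1 : ℤ)) (fun _ : Fin s' => -1))
    (Fin.append C C') (Fin.append k k')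
    (fun j => by refine Fin.addCases (fun i => ?_) (fun i => ?_) j <;> simp [hC, hC'])
    (fun x => by
      simp only [Fin.sum_univ_add, Fin.append_left, Fin.append_right, one_mul, neg_one_mul,
        Finset.sum_neg_distrib, ind C hd hA x, ind C' hd' hA' x, add_neg_cancel])
  simp only [Fin.sum_univ_add, Fin.append_left, Fin.append_right, one_mul, neg_one_mul,
    Finset.sum_neg_distrib] at this
  linarith

theorem HasEulerChar.eulerCharC_eq {N : ℕ} {A : Set (Fin N → ℝ)} {c : ℤ}
    (h : HasEulerChar A c) : eulerCharC A = c := by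
  have h' : ∃ c, HasEulerChar A c := ⟨c, h⟩
  rw [eulerCharC, dif_pos h']
  exact h'.choose_spec.unique h

/-! ### Truncated arcs and zeta functions -/

/-- The truncated arc `γ(t) = a₁ t + a₂ t² + ⋯ + aₙ tⁿ` in `ℝ^d` at the origin. The space of these
arcs is identified with `ℝ^(d * n)`: the `i`-th component of the coefficient of `t^(k+1)`
is the coordinate number `i * n + k` (both counted from zero). -/
noncomputable def truncArc {d n : ℕ} (a : Fin (d * n) → ℝ) (t : ℝ) : Fin d → ℝ :=
  fun i => ∑ k : Fin n, a (finProdFinEquiv (i, k)) * t ^ ((k : ℕ) + 1)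

/-- The set `𝒳_{n,+}(f)` of the truncated arcs `γ` with `f(γ(t)) = c tⁿ + ⋯`, `c > 0`. -/
def arcsPos {d : ℕ} (n : ℕ) (f : (Fin d → ℝ) → ℝ) : Set (Fin (d * n) → ℝ) :=
  {a | ∃ c : ℝ, 0 < c ∧
    (fun t : ℝ => f (truncArc a t) - c * t ^ n) =O[𝓝 0] (fun t : ℝ => t ^ (n + 1))}

/-- The set `𝒳_{n,-}(f)` of the truncated arcs `γ` with `f(γ(t)) = c tⁿ + ⋯`, `c < 0`. -/
def arcsNeg {d : ℕ} (n : ℕ) (f : (Fin d → ℝ) → ℝ) : Set (Fin (d * n) → ℝ) :=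
  {a | ∃ c : ℝ, c < 0 ∧
    (fun t : ℝ => f (truncArc a t) - c * t ^ n) =O[𝓝 0] (fun t : ℝ => t ^ (n + 1))}

/-- The positive zeta function `Z_{f,+}(T) = ∑_{n ≥ 1} (-1)^(-nd) χ^c(𝒳_{n,+}(f)) Tⁿ`. -/
noncomputable def zetaPos {d : ℕ} (f : (Fin d → ℝ) → ℝ) : PowerSeries ℤ :=
  PowerSeries.mk fun n => if n = 0 then 0 else (-1) ^ (n * d) * eulerCharC (arcsPos n f)

/-- The negative zeta function `Z_{f,-}(T) = ∑_{n ≥ 1} (-1)^(-nd) χ^c(𝒳_{n,-}(f)) Tⁿ`. -/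
noncomputable def zetaNeg {d : ℕ} (f : (Fin d → ℝ) → ℝ) : PowerSeries ℤ :=
  PowerSeries.mk fun n => if n = 0 then 0 else (-1) ^ (n * d) * eulerCharC (arcsNeg n f)

/-- The Brieskorn polynomial `f(x) = ± x₁^{m₁} ± ⋯ ± x_d^{m_d}`. -/
def brieskorn {d : ℕ} (ε : Fin d → ℤˣ) (m : Fin d → ℕ) : (Fin d → ℝ) → ℝ :=
  fun x => ∑ i, ((ε i : ℤ) : ℝ) * x i ^ m i

/-- The monomial `g(y) = ± y^r` in one variable. -/
def signedPower (δ : ℤˣ) (r : ℕ) : (Fin 1 → ℝ) → ℝ :=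
  fun y => ((δ : ℤ) : ℝ) * y 0 ^ r

/-- `(f * g)(x, y) = f(x) + g(y)` on `ℝ^{d₁} × ℝ^{d₂} = ℝ^{d₁ + d₂}`. -/
def tsSum {d₁ d₂ : ℕ} (f : (Fin d₁ → ℝ) → ℝ) (g : (Fin d₂ → ℝ) → ℝ) : (Fin (d₁ + d₂) → ℝ) → ℝ :=
  fun z => f (fun i => z (Fin.castAdd d₂ i)) + g (fun j => z (Fin.natAdd d₁ j))

/-! ### Building partitions into cells -/

/-! The two zeta functions are traded for an invariant that is multiplicative under `f * g`. For a
sign `τ`, let `A_τ(k)` be the Euler characteristic, normalized by `(-1)^(nd)`, of the arcs along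
which `f` vanishes below `t^k` and has a coefficient at `t^k` that is zero or of sign `τ`. If `o_k`
is the normalized Euler characteristic of the arcs of order larger than `k`, inclusion-exclusion
gives `o_k = A_+(k) + A_-(k) - o_(k-1)` with `o_0 = 1`, and the coefficient of `T^k` in the zeta
function of sign `±` is `o_(k-1) - A_∓(k)`. By induction the zeta functions determine `A_±`
(`modProd_eq_of_zeta_eq`).

Multiplicativity is proved by adding one monomial `δ y^m` at a time (`SeqEulerChar.exists_addPow`).
If the leading terms of the two summands do not cancel, the leading term of the sum satisfies the
condition defining `A_τ(k)` exactly when both summands do. If they can cancel, the leading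
coefficient of `y` is cut by the root where cancellation occurs; at the root, each later coefficient
of the sum is affine with nonzero slope in a fresh coordinate. All strata are thus iterated graphs,
segments, half lines and lines, and their signed count agrees with the product
(`sum_cancelWeight_mul_leadIndicator`). No general theorem on semialgebraic sets is needed: the
cells are built one coordinate at a time, in spaces of sequences.

For one monomial `δ y^m`, `A_τ(k)` is explicit (`modCoeff`): it is `±1`, except that it is `0` if
`m` is odd and divides `k`. Hence if no odd `m_i` divides `k`, the factor of `f` can be cancelled
and `A_±(k)` of `g` is known; it tells whether `r` divides `k`. If such `k` include `r₁` or `r₂`,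
then `r₁` and `r₂` divide each other. Otherwise both exceed `1`, and the powers of `2` are
admissible values of `k`: the parities of `⌊2^t / r⌋` are the binary digits of `1 / r`, which
determine `r` (`eq_of_two_pow_div_parity`). For even admissible `r`, the value at `k = r` shows the
sign. -/

theorem HasEulerChar.of_fintype {N : ℕ} {ι : Type*} [Fintype ι] {A : Set (Fin N → ℝ)}
    (C : ι → Set (Fin N → ℝ)) (k : ι → ℕ) (hC : ∀ j, IsCell N (k j) (C j))
    (hd : Pairwise fun i j => Disjoint (C i) (C j)) (hA : (⋃ j, C j) = A) :
    HasEulerChar A (∑ j, (-1) ^ k j) := by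
  let e := Fintype.equivFin ι
  refine ⟨Fintype.card ι, fun j => C (e.symm j), fun j => k (e.symm j), fun j => hC _,
    fun i j hij => hd (e.symm.injective.ne hij), ?_, ?_⟩
  · rw [← hA]
    exact e.symm.surjective.iUnion_comp C
  · exact (Equiv.sum_comp e.symm fun j => (-1 : ℤ) ^ k j).symm

/-- Additivity of the Euler characteristic. -/
theorem HasEulerChar.iUnion {N : ℕ} {ι : Type*} [Fintype ι] {A : ι → Set (Fin N → ℝ)}
    {c : ι → ℤ} (h : ∀ i, HasEulerChar (A i) (c i))
    (hd : Pairwise fun i j => Disjoint (A i) (A j)) : HasEulerChar (⋃ i, A i) (∑ i, c i) := by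
  choose s C k hC hCd hA hc using h
  have hsub : ∀ i j, C i j ⊆ A i := fun i j => by
    rw [← hA i]; exact Set.subset_iUnion (C i) j
  have := HasEulerChar.of_fintype (A := ⋃ i, A i) (fun p : Σ i, Fin (s i) => C p.1 p.2)
    (fun p => k p.1 p.2) (fun p => hC _ _) ?_ ?_
  · rw [Fintype.sum_sigma] at this
    simpa only [hc] using this
  · rintro ⟨i, a⟩ ⟨j, b⟩ hne
    by_cases hij : i = j
    · subst hij
      refine hCd i fun hab => hne ?_
      exact Sigma.ext rfl (heq_of_eq hab)
    · exact (hd hij).mono (hsub i a) (hsub j b)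
  · rw [Set.iUnion_sigma]
    exact Set.iUnion_congr hA

theorem HasEulerChar.graph {N : ℕ} {A : Set (Fin N → ℝ)} {c : ℤ} (h : HasEulerChar A c)
    {φ : (Fin N → ℝ) → ℝ} (hφ : ContinuousOn φ A) :
    HasEulerChar {x : Fin (N + 1) → ℝ | Fin.init x ∈ A ∧ x (Fin.last N) = φ (Fin.init x)} c := by
  obtain ⟨s, C, k, hC, hd, rfl, rfl⟩ := h
  refine HasEulerChar.of_fintype _ k
    (fun j => (hC j).graph φ (hφ.mono (Set.subset_iUnion C j))) (fun i j hij => ?_) ?_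
  · exact Set.disjoint_left.2 fun x hx hx' => Set.disjoint_left.1 (hd hij) hx.1 hx'.1
  · ext x; simp

theorem HasEulerChar.band {N : ℕ} {A : Set (Fin N → ℝ)} {c : ℤ} (h : HasEulerChar A c)
    {φ ψ : (Fin N → ℝ) → EReal} (hφ : ContinuousOn φ A) (hψ : ContinuousOn ψ A)
    (hlt : ∀ x ∈ A, φ x < ψ x) :
    HasEulerChar {x : Fin (N + 1) → ℝ | Fin.init x ∈ A ∧
      φ (Fin.init x) < (x (Fin.last N) : EReal) ∧
      (x (Fin.last N) : EReal) < ψ (Fin.init x)} (-c) := by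
  obtain ⟨s, C, k, hC, hd, rfl, rfl⟩ := h
  have hs := Set.subset_iUnion C
  have := HasEulerChar.of_fintype _ (fun j => k j + 1)
    (fun j => (hC j).band φ ψ (hφ.mono (hs j)) (hψ.mono (hs j)) fun x hx => hlt x (hs j hx))
    (fun i j hij => Set.disjoint_left.2 fun x hx hx' =>
      Set.disjoint_left.1 (hd hij) hx.1 hx'.1) rfl
  convert this using 1
  · ext x; simp
  · simp [pow_succ]

/-! ### Sets of sequences -/

/-- The sequence that starts with the vector `x` and continues with zeros. -/
def extendZero {N : ℕ} (x : Fin N → ℝ) : ℕ → ℝ := fun i => if h : i < N then x ⟨i, h⟩ else 0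

/-- The sequence `x` with the entries from the `N`-th on replaced by zeros. -/
def truncSeq (N : ℕ) (x : ℕ → ℝ) : ℕ → ℝ := fun i => if i < N then x i else 0

/-- The sequences in `S` that vanish from the `N`-th entry on form a set with Euler
characteristic `c`. -/
def SeqEulerChar (N : ℕ) (S : Set (ℕ → ℝ)) (c : ℤ) : Prop :=
  HasEulerChar {x : Fin N → ℝ | extendZero x ∈ S} c

theorem truncSeq_apply_of_lt {N i : ℕ} (h : i < N) (x : ℕ → ℝ) : truncSeq N x i = x i := by
  simp [truncSeq, h]

theorem truncSeq_apply_of_le {N i : ℕ} (h : N ≤ i) (x : ℕ → ℝ) : truncSeq N x i = 0 := by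
  simp [truncSeq, h]

theorem truncSeq_truncSeq {M N : ℕ} (h : M ≤ N) (x : ℕ → ℝ) :
    truncSeq M (truncSeq N x) = truncSeq M x := by
  funext i
  simp only [truncSeq]
  split_ifs <;> first | rfl | omega

theorem continuous_truncSeq (N : ℕ) : Continuous (truncSeq N) := by
  refine continuous_pi fun i => ?_
  by_cases h : i < N
  · simpa only [truncSeq, h, if_true] using continuous_apply i
  · simpa only [truncSeq, h, if_false] using continuous_const

theorem continuous_extendZero (N : ℕ) : Continuous (extendZero : (Fin N → ℝ) → ℕ → ℝ) := by
  refine continuous_pi fun i => ?_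
  by_cases h : i < N
  · simpa only [extendZero, h, dif_pos] using continuous_apply _
  · simpa only [extendZero, h, dif_neg, not_false_iff] using continuous_const

theorem truncSeq_extendZero {N : ℕ} (x : Fin N → ℝ) : truncSeq N (extendZero x) = extendZero x := by
  funext i
  by_cases h : i < N <;> simp [truncSeq, extendZero, h]

theorem extendZero_init {N : ℕ} (x : Fin (N + 1) → ℝ) :
    extendZero (Fin.init x) = truncSeq N (extendZero x) := by
  funext i
  by_cases h : i < N
  · have h' : i < N + 1 := by omega
    simp [truncSeq, extendZero, h, h', Fin.init]
  · simp [truncSeq, extendZero, h]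

theorem extendZero_last {N : ℕ} (x : Fin (N + 1) → ℝ) : extendZero x N = x (Fin.last N) := by
  simp [extendZero, Fin.last]

namespace SeqEulerChar

variable {N : ℕ} {S : Set (ℕ → ℝ)} {c : ℤ}

theorem congr {S' : Set (ℕ → ℝ)} (h : SeqEulerChar N S c)
    (hS : ∀ x, truncSeq N x = x → (x ∈ S ↔ x ∈ S')) : SeqEulerChar N S' c := by
  have : {x : Fin N → ℝ | extendZero x ∈ S'} = {x : Fin N → ℝ | extendZero x ∈ S} := by
    ext x
    exact (hS _ (truncSeq_extendZero x)).symm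
  unfold SeqEulerChar
  rwa [this]

theorem empty : SeqEulerChar N ∅ 0 :=
  ⟨0, fun _ => ∅, fun _ => 0, fun j => j.elim0, fun j => j.elim0, by ext; simp, by simp⟩

theorem zero_univ : SeqEulerChar 0 Set.univ 1 :=
  ⟨1, fun _ => Set.univ, fun _ => 0, fun _ => IsCell.point,
    fun i j h => absurd (Subsingleton.elim i j) h, by ext; simp, by simp⟩

theorem sum {ι : Type*} [Fintype ι] {c : ι → ℤ} (P : ι → (ℕ → ℝ) → Prop)
    (hP : ∀ x ∈ S, ∃! i, P i x) (h : ∀ i, SeqEulerChar N {x | x ∈ S ∧ P i x} (c i)) :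
    SeqEulerChar N S (∑ i, c i) := by
  have := HasEulerChar.iUnion h fun i j hij => Set.disjoint_left.2 fun x hx hx' =>
    hij ((hP _ hx.1).unique hx.2 hx'.2)
  unfold SeqEulerChar
  convert this using 1
  ext x
  simp only [Set.mem_ofPred_eq, Set.mem_iUnion]
  exact ⟨fun hx => ((hP _ hx).exists).imp fun i hi => ⟨hx, hi⟩, fun ⟨i, hi⟩ => hi.1⟩

theorem graph (h : SeqEulerChar N S c) {φ : (ℕ → ℝ) → ℝ} (hφ : ContinuousOn φ S) :
    SeqEulerChar (N + 1) {x | truncSeq N x ∈ S ∧ x N = φ (truncSeq N x)} c := by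
  have := HasEulerChar.graph h (φ := fun x => φ (extendZero x))
    (hφ.comp (continuous_extendZero N).continuousOn fun x hx => hx)
  simpa only [SeqEulerChar, Set.mem_ofPred_eq, extendZero_init, extendZero_last] using this

theorem band (h : SeqEulerChar N S c) {φ ψ : (ℕ → ℝ) → EReal} (hφ : ContinuousOn φ S)
    (hψ : ContinuousOn ψ S) (hlt : ∀ x ∈ S, φ x < ψ x) :
    SeqEulerChar (N + 1) {x | truncSeq N x ∈ S ∧ φ (truncSeq N x) < (x N : EReal) ∧
      (x N : EReal) < ψ (truncSeq N x)} (-c) := by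
  have := HasEulerChar.band h (φ := fun x => φ (extendZero x)) (ψ := fun x => ψ (extendZero x))
    (hφ.comp (continuous_extendZero N).continuousOn fun x hx => hx)
    (hψ.comp (continuous_extendZero N).continuousOn fun x hx => hx) fun x hx => hlt _ hx
  simpa only [SeqEulerChar, Set.mem_ofPred_eq, extendZero_init, extendZero_last] using this

theorem line (h : SeqEulerChar N S c) : SeqEulerChar (N + 1) {x | truncSeq N x ∈ S} (-c) := by
  refine (h.band (φ := fun _ => ⊥) (ψ := fun _ => ⊤) continuousOn_const continuousOn_const
    fun _ _ => bot_lt_top).congr fun x _ => ?_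
  simp [EReal.bot_lt_coe, EReal.coe_lt_top]

theorem halfLine (h : SeqEulerChar N S c) {φ : (ℕ → ℝ) → ℝ} (hφ : ContinuousOn φ S) (σ : ℤˣ) :
    SeqEulerChar (N + 1)
      {x | truncSeq N x ∈ S ∧ 0 < ((σ : ℤ) : ℝ) * (x N - φ (truncSeq N x))} (-c) := by
  have hφ' : ContinuousOn (fun x => (φ x : EReal)) S :=
    continuous_coe_real_ereal.comp_continuousOn hφ
  rcases Int.units_eq_one_or σ with rfl | rfl
  · refine (h.band (ψ := fun _ => ⊤) hφ' continuousOn_const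
      fun _ _ => EReal.coe_lt_top _).congr fun x _ => ?_
    simp [EReal.coe_lt_top]
  · refine (h.band (φ := fun _ => ⊥) continuousOn_const hφ'
      fun _ _ => EReal.bot_lt_coe _).congr fun x _ => ?_
    simp [EReal.bot_lt_coe]

theorem segment (h : SeqEulerChar N S c) {ρ : (ℕ → ℝ) → ℝ} (hρ : ContinuousOn ρ S)
    (hpos : ∀ x ∈ S, 0 < ρ x) (σ : ℤˣ) :
    SeqEulerChar (N + 1) {x | truncSeq N x ∈ S ∧ 0 < ((σ : ℤ) : ℝ) * x N ∧
      ((σ : ℤ) : ℝ) * x N < ρ (truncSeq N x)} (-c) := by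
  rcases Int.units_eq_one_or σ with rfl | rfl
  · refine (h.band (φ := fun _ => ((0 : ℝ) : EReal)) (ψ := fun x => (ρ x : EReal))
      continuousOn_const (continuous_coe_real_ereal.comp_continuousOn hρ)
      fun x hx => EReal.coe_lt_coe_iff.2 (hpos x hx)).congr fun x _ => ?_
    simp
  · refine (h.band (φ := fun x => ((-ρ x : ℝ) : EReal)) (ψ := fun _ => ((0 : ℝ) : EReal))
      (continuous_coe_real_ereal.comp_continuousOn hρ.neg) continuousOn_const
      fun x hx => EReal.coe_lt_coe_iff.2 (neg_lt_zero.2 (hpos x hx))).congr fun x _ => ?_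
    simp only [Set.mem_ofPred_eq, EReal.coe_lt_coe_iff]
    refine and_congr_right fun _ => ?_
    simp only [Units.val_neg, Units.val_one, Int.cast_neg, Int.cast_one, neg_one_mul]
    constructor <;> rintro ⟨h1, h2⟩ <;> constructor <;> linarith

theorem free (h : SeqEulerChar N S c) (j : ℕ) :
    SeqEulerChar (N + j) {x | truncSeq N x ∈ S} ((-1) ^ j * c) := by
  induction j with
  | zero =>
    rw [pow_zero, one_mul]
    exact h.congr fun x hx => by rw [Set.mem_ofPred_eq, hx]
  | succ j ih =>
    have := ih.line
    rw [pow_succ, mul_neg_one, neg_mul]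
    refine this.congr fun x _ => ?_
    simp only [Set.mem_ofPred_eq]
    rw [truncSeq_truncSeq (by omega)]

/-- A chain of graphs and half lines: the functions `g j` depend on the new coordinates up to the
`j`-th one, and are affine with slope `β` in the latter. -/
theorem affine_zero (h : SeqEulerChar N S c) {g φ : ℕ → (ℕ → ℝ) → ℝ} {β : (ℕ → ℝ) → ℝ} {i : ℕ}
    (hg : ∀ j < i, ∀ x, truncSeq N x ∈ S →
      g j x = φ j (truncSeq (N + j) x) + β (truncSeq N x) * x (N + j))
    (hφ : ∀ j < i, Continuous (φ j)) (hβ : Continuous β) (hne : ∀ x ∈ S, β x ≠ 0) :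
    SeqEulerChar (N + i) {x | truncSeq N x ∈ S ∧ ∀ j < i, g j x = 0} c := by
  induction i with
  | zero => exact h.congr fun x hx => by simp [show truncSeq N x = x from hx]
  | succ i ih =>
    have h1 := ih (fun j hj => hg j (by omega)) fun j hj => hφ j (by omega)
    have h2 := h1.graph (φ := fun x => - φ i x / β (truncSeq N x)) ?_
    · refine h2.congr fun x _ => ?_
      simp only [Set.mem_ofPred_eq, truncSeq_truncSeq (show N ≤ N + i by omega)]
      rw [and_assoc]
      refine and_congr_right fun hx => ?_
      have h3 : ∀ j < i, g j (truncSeq (N + i) x) = g j x := fun j hj => by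
        rw [hg j (by omega) _ (by rwa [truncSeq_truncSeq (by omega)]), hg j (by omega) _ hx,
          truncSeq_truncSeq (by omega), truncSeq_truncSeq (by omega),
          truncSeq_apply_of_lt (by omega)]
      have h4 : x (N + i) = - φ i (truncSeq (N + i) x) / β (truncSeq N x) ↔ g i x = 0 := by
        rw [hg i (by omega) _ hx, eq_div_iff (hne _ hx)]
        constructor <;> intro h <;> linarith
      rw [h4]
      constructor
      · rintro ⟨h5, h6⟩ j hj
        rcases Nat.lt_succ_iff_lt_or_eq.1 hj with hj | rfl
        · rw [← h3 j hj]; exact h5 j hj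
        · exact h6
      · exact fun h5 => ⟨fun j hj => by rw [h3 j hj]; exact h5 j (by omega), h5 i (by omega)⟩
    · refine ContinuousOn.div (hφ i (by omega)).neg.continuousOn
        (hβ.comp (continuous_truncSeq N)).continuousOn fun x hx => hne _ hx.1

/-- The zero conditions are solved by graphs, and the sign condition puts one more coordinate on a
half line, whence `-c`. The sign of the slope must be constant on `S` so that all half lines point
the same way. -/
theorem affine_sign (h : SeqEulerChar N S c) {g φ : ℕ → (ℕ → ℝ) → ℝ} {β : (ℕ → ℝ) → ℝ} {i : ℕ}
    (hg : ∀ j < i + 1, ∀ x, truncSeq N x ∈ S →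
      g j x = φ j (truncSeq (N + j) x) + β (truncSeq N x) * x (N + j))
    (hφ : ∀ j < i + 1, Continuous (φ j)) (hβ : Continuous β) (b : ℤˣ)
    (hb : ∀ x ∈ S, 0 < ((b : ℤ) : ℝ) * β x) (τ : ℤˣ) :
    SeqEulerChar (N + i + 1)
      {x | truncSeq N x ∈ S ∧ (∀ j < i, g j x = 0) ∧ 0 < ((τ : ℤ) : ℝ) * g i x} (-c) := by
  have hne : ∀ x ∈ S, β x ≠ 0 := fun x hx h0 => by
    have := hb x hx
    rw [h0] at this
    simp at this
  have h1 := h.affine_zero (fun j (hj : j < i) => hg j (by omega)) (fun j hj => hφ j (by omega))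
    hβ hne
  have h2 := h1.halfLine (φ := fun x => - φ i x / β (truncSeq N x)) ?_ (τ * b)
  · refine h2.congr fun x _ => ?_
    simp only [Set.mem_ofPred_eq, truncSeq_truncSeq (show N ≤ N + i by omega)]
    rw [and_assoc]
    refine and_congr_right fun hx => and_congr (forall₂_congr fun j hj => ?_) ?_
    · rw [hg j (by omega) _ (by rwa [truncSeq_truncSeq (by omega)]), hg j (by omega) _ hx,
        truncSeq_truncSeq (by omega), truncSeq_truncSeq (by omega),
        truncSeq_apply_of_lt (by omega)]
    · rw [hg i (by omega) _ hx]
      have hb' := hb _ hx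
      have hbb : ((b : ℤ) : ℝ) * ((b : ℤ) : ℝ) = 1 := by
        rcases Int.units_eq_one_or b with rfl | rfl <;> simp
      have h3 : φ i (truncSeq (N + i) x) + β (truncSeq N x) * x (N + i) =
          (((b : ℤ) : ℝ) * (x (N + i) - - φ i (truncSeq (N + i) x) / β (truncSeq N x))) *
          (((b : ℤ) : ℝ) * β (truncSeq N x)) := by
        have := hne _ hx
        field_simp
        linear_combination (-(φ i (truncSeq (N + i) x) + β (truncSeq N x) * x (N + i))) * hbb
      rw [h3, ← mul_assoc, Units.val_mul, Int.cast_mul, mul_pos_iff_of_pos_right hb', mul_assoc]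
  · refine ContinuousOn.div (hφ i (by omega)).neg.continuousOn
      (hβ.comp (continuous_truncSeq N)).continuousOn fun x hx => hne _ hx.1

end SeqEulerChar

/-! ### Leading terms -/

/-- The possible leading terms, up to a positive factor, of a sequence of `n` coefficients: `none` if
they all vanish, `some (s, σ)` if the first nonzero one has index `s` and sign `σ`. -/
abbrev LeadTerm (n : ℕ) := Option (Fin n × ℤˣ)

/-- The first `n` entries of the sequence `c` have the given leading term. -/
def HasLead {n : ℕ} : LeadTerm n → (ℕ → ℝ) → Prop
  | none, c => ∀ j < n, c j = 0
  | some (s, σ), c => (∀ j < (s : ℕ), c j = 0) ∧ 0 < ((σ : ℤ) : ℝ) * c s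

theorem ne_zero_of_units_mul_pos {σ : ℤˣ} {a : ℝ} (h : 0 < ((σ : ℤ) : ℝ) * a) : a ≠ 0 := by
  rintro rfl
  simp at h

theorem eq_of_units_mul_pos {σ τ : ℤˣ} {a : ℝ} (h : 0 < ((σ : ℤ) : ℝ) * a)
    (h' : 0 < ((τ : ℤ) : ℝ) * a) : σ = τ := by
  rcases Int.units_eq_one_or σ with rfl | rfl <;> rcases Int.units_eq_one_or τ with rfl | rfl <;>
    simp at h h' ⊢ <;> linarith

theorem exists_units_mul_pos {a : ℝ} (h : a ≠ 0) : ∃ σ : ℤˣ, 0 < ((σ : ℤ) : ℝ) * a := by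
  rcases lt_or_gt_of_ne h with h | h
  · exact ⟨-1, by simpa using h⟩
  · exact ⟨1, by simpa using h⟩

theorem HasLead.unique {n : ℕ} {E F : LeadTerm n} {c : ℕ → ℝ} (hE : HasLead E c)
    (hF : HasLead F c) : E = F := by
  rcases E with _ | ⟨s, σ⟩ <;> rcases F with _ | ⟨t, τ⟩
  · rfl
  · exact absurd (hE t t.2) (ne_zero_of_units_mul_pos hF.2)
  · exact absurd (hF s s.2) (ne_zero_of_units_mul_pos hE.2)
  · obtain rfl : s = t := by
      refine Fin.ext (le_antisymm ?_ ?_)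
      · by_contra! h
        exact ne_zero_of_units_mul_pos hF.2 (hE.1 t h)
      · by_contra! h
        exact ne_zero_of_units_mul_pos hE.2 (hF.1 s h)
    rw [eq_of_units_mul_pos hE.2 hF.2]

theorem existsUnique_hasLead (n : ℕ) (c : ℕ → ℝ) : ∃! E : LeadTerm n, HasLead E c := by
  refine existsUnique_of_exists_of_unique ?_ fun E F hE hF => hE.unique hF
  classical
  by_cases h : ∃ j, j < n ∧ c j ≠ 0
  · obtain ⟨h1, h2⟩ := Nat.find_spec h
    obtain ⟨σ, hσ⟩ := exists_units_mul_pos h2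
    refine ⟨some (⟨Nat.find h, h1⟩, σ), fun j hj => ?_, hσ⟩
    by_contra h3
    exact Nat.find_min h hj ⟨hj.trans h1, h3⟩
  · push Not at h
    exact ⟨none, h⟩

/-- The indicator of the sequences with leading term `E` whose first `k` entries vanish and whose
`k`-th entry vanishes or has sign `τ`. -/
def leadIndicator {n : ℕ} (k : ℕ) (τ : ℤˣ) : LeadTerm n → ℤ
  | none => 1
  | some (s, σ) => if k < s ∨ (k = s ∧ σ = τ) then 1 else 0

/-- The leading terms `E` and `F` may cancel. -/
def Cancels {n : ℕ} (E F : LeadTerm n) : Prop :=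
  ∃ l τ, E = some (l, τ) ∧ F = some (l, -τ)

/-- Without cancellation the term of smaller index wins, or the two share index and sign. If the
earlier term passes the test for `(k, τ)`, a strictly later one has index above `k` and passes too,
so the test is multiplicative. -/
theorem exists_hasLead_add {n : ℕ} {E F : LeadTerm n} (h : ¬ Cancels E F) :
    ∃ G : LeadTerm n, (∀ a b, HasLead E a → HasLead F b → HasLead G fun j => a j + b j) ∧
      ∀ k τ, leadIndicator k τ G = leadIndicator k τ E * leadIndicator k τ F := by
  rcases E with _ | ⟨s, σ⟩
  · refine ⟨F, fun a b ha hb => ?_, fun k τ => by simp [leadIndicator]⟩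
    rcases F with _ | ⟨t, τ⟩
    · intro j hj
      simp only [ha j hj, hb j hj, add_zero]
    · refine ⟨fun j hj => ?_, ?_⟩
      · simp only [ha j (hj.trans t.2), hb.1 j hj, add_zero]
      · simpa only [ha t t.2, zero_add] using hb.2
  rcases F with _ | ⟨t, τ⟩
  · refine ⟨some (s, σ), fun a b ha hb => ?_, fun k τ => by simp [leadIndicator]⟩
    refine ⟨fun j hj => ?_, ?_⟩
    · simp only [hb j (hj.trans s.2), ha.1 j hj, add_zero]
    · simpa only [hb s s.2, add_zero] using ha.2
  rcases lt_trichotomy s t with hst | rfl | hst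
  · refine ⟨some (s, σ), fun a b ha hb => ⟨fun j hj => ?_, ?_⟩, fun k υ => ?_⟩
    · simp only [hb.1 j (hj.trans hst), ha.1 j hj, add_zero]
    · simpa only [hb.1 s hst, add_zero] using ha.2
    · have : (s : ℕ) < t := hst
      simp only [leadIndicator]
      split_ifs <;> first | rfl | omega
  · have hστ : σ = τ := by
      by_contra hne
      refine h ⟨s, σ, rfl, ?_⟩
      rw [show τ = -σ from ?_]
      rcases Int.units_eq_one_or σ with rfl | rfl <;> rcases Int.units_eq_one_or τ with rfl | rfl <;>
        simp at hne ⊢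
    subst hστ
    refine ⟨some (s, σ), fun a b ha hb => ⟨fun j hj => ?_, ?_⟩, fun k υ => ?_⟩
    · simp only [hb.1 j hj, ha.1 j hj, add_zero]
    · simp only [mul_add]
      exact add_pos ha.2 hb.2
    · simp only [leadIndicator]
      split_ifs <;> rfl
  · refine ⟨some (t, τ), fun a b ha hb => ⟨fun j hj => ?_, ?_⟩, fun k υ => ?_⟩
    · simp only [hb.1 j hj, ha.1 j (hj.trans hst), add_zero]
    · simpa only [ha.1 t hst, zero_add] using hb.2
    · have : (t : ℕ) < s := hst
      simp only [leadIndicator]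
      split_ifs <;> first | rfl | omega

/-! ### Weights -/

theorem sum_leadTerm {n : ℕ} (f : LeadTerm n → ℤ) :
    ∑ E, f E = f none + ∑ s : Fin n, (f (some (s, 1)) + f (some (s, -1))) := by
  rw [Fintype.sum_option, Fintype.sum_prod_type]
  simp [UnitsInt.univ]

/-- The factor `2` accounts for the two signs of a leading term of given index. -/
theorem two_mul_sum_neg_one_pow {a n : ℕ} (h : a ≤ n) :
    2 * ∑ j ∈ Finset.range n, (if j < a then 0 else (-1 : ℤ) ^ j) = (-1) ^ a - (-1) ^ n := by
  induction n, h using Nat.le_induction with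
  | base =>
    rw [Finset.sum_eq_zero fun j hj => if_pos (Finset.mem_range.1 hj)]
    simp
  | succ n hn ih =>
    rw [Finset.sum_range_succ, mul_add, ih, if_neg (by omega), pow_succ]
    ring

/-- The Euler characteristic of the sequences of length `n` with a given leading term. -/
def leadWeight {n : ℕ} : LeadTerm n → ℤ
  | none => 1
  | some (s, _) => (-1) ^ (n + s)

/-- The relative Euler characteristics of the leading terms of a sum when the leading terms
of index `l` of the summands may cancel. -/
def cancelWeight {n : ℕ} (l : ℕ) : LeadTerm n → ℤ
  | none => (-1) ^ (n + l)
  | some (s, _) => if (s : ℕ) < l then 0 else (-1) ^ (s + l)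

theorem sum_leadWeight (n : ℕ) : ∑ E : LeadTerm n, leadWeight E = (-1) ^ n := by
  have h := two_mul_sum_neg_one_pow (Nat.zero_le n)
  have h2 : ((-1 : ℤ) ^ n) * (-1) ^ n = 1 := by rw [← mul_pow]; simp
  simp only [sum_leadTerm, leadWeight, ← two_mul, ← Finset.mul_sum, pow_add]
  rw [Fin.sum_univ_eq_sum_range (fun j => (-1 : ℤ) ^ j)]
  simp only [Nat.not_lt_zero, if_false, pow_zero] at h
  linear_combination ((-1 : ℤ) ^ n) * h - h2

theorem sum_cancelWeight {n l : ℕ} (hl : l ≤ n) : ∑ E : LeadTerm n, cancelWeight l E = 1 := by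
  have h := two_mul_sum_neg_one_pow hl
  have h2 : ((-1 : ℤ) ^ l) * (-1) ^ l = 1 := by rw [← mul_pow]; simp
  simp only [sum_leadTerm, cancelWeight, ← two_mul, ← Finset.mul_sum]
  have h3 : ∀ s : ℕ, (if s < l then (0 : ℤ) else (-1) ^ (s + l)) =
      (-1) ^ l * if s < l then 0 else (-1) ^ s := fun s => by
    split_ifs
    · simp
    · ring
  rw [Fin.sum_univ_eq_sum_range (fun s => if s < l then (0 : ℤ) else (-1) ^ (s + l))]
  simp only [h3, ← Finset.mul_sum]
  rw [pow_add]
  linear_combination ((-1 : ℤ) ^ l) * h + h2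

/-- This is why cancellation does not spoil multiplicativity. For `k < l` every term of nonzero
weight passes the test and the total weight is `1`. For `l ≤ k` the product is `0`, since two
opposite signs cannot both be `υ`; the alternating sum over the indices from `k` on, together with
`none`, vanishes as well. -/
theorem sum_cancelWeight_mul_leadIndicator {n k : ℕ} (hk : k < n) (l : Fin n) (τ υ : ℤˣ) :
    ∑ E : LeadTerm n, cancelWeight l E * leadIndicator k υ E =
      leadIndicator k υ (some (l, τ)) * leadIndicator k υ (some (l, -τ)) := by
  rcases lt_or_ge k l with hkl | hkl
  · have : ∀ E : LeadTerm n, cancelWeight l E * leadIndicator k υ E = cancelWeight l E := by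
      rintro (_ | ⟨s, σ⟩)
      · simp [leadIndicator]
      · simp only [leadIndicator, cancelWeight]
        split_ifs <;> omega
    rw [Finset.sum_congr rfl fun E _ => this E, sum_cancelWeight l.2.le]
    simp [leadIndicator, hkl]
  · have h0 : leadIndicator k υ (some (l, τ)) * leadIndicator k υ (some (l, -τ)) = 0 := by
      have h1 : ¬ k < l := by omega
      have h2 : ¬ (τ = υ ∧ -τ = υ) := by
        rintro ⟨rfl, h⟩
        rcases Int.units_eq_one_or τ with rfl | rfl <;> simp at h
      simp only [leadIndicator, h1, false_or]
      by_cases h3 : k = l ∧ τ = υ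
      · have h4 : ¬ (k = l ∧ -τ = υ) := fun h4 => h2 ⟨h3.2, h4.2⟩
        rw [if_neg h4, mul_zero]
      · rw [if_neg h3, zero_mul]
    rw [h0, sum_leadTerm]
    have h := two_mul_sum_neg_one_pow (show k + 1 ≤ n by omega)
    -- Indices above `k` count with both signs, the index `k` with the sign `υ` only.
    have h3 : ∀ s : Fin n, cancelWeight l (some (s, (1 : ℤˣ))) * leadIndicator k υ (some (s, 1)) +
        cancelWeight l (some (s, (-1 : ℤˣ))) * leadIndicator k υ (some (s, -1)) =
        (fun s : ℕ => (-1) ^ l.1 * (2 * (if s < k + 1 then 0 else (-1) ^ s) +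
          if s = k then (-1) ^ k else 0)) s := by
      intro s
      simp only [cancelWeight, leadIndicator]
      rcases lt_trichotomy k s with hks | hks | hks
      · rw [if_neg (by omega), if_pos (by omega), if_pos (by omega), if_neg (by omega),
          if_neg (by omega)]
        ring
      · have h4 : ¬ (s : ℕ) < l := by omega
        have h5 : (s : ℕ) < k + 1 := by omega
        have h6 : ¬ k < (s : ℕ) := by omega
        rw [← hks] at h4 h5 h6
        simp only [h4, h5, h6, if_true, if_false, ← hks, true_and, false_or]
        rcases Int.units_eq_one_or υ with rfl | rfl
        · rw [if_pos rfl, if_neg (by decide)]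
          ring
        · rw [if_neg (by decide), if_pos rfl]
          ring
      · have h4 : ¬ k < (s : ℕ) := by omega
        have h5 : (s : ℕ) < k + 1 := by omega
        have h6 : ¬ k = (s : ℕ) := by omega
        simp only [h4, h5, h6, hks.ne, if_true, if_false, false_and, false_or]
        ring
    rw [Finset.sum_congr rfl fun s _ => h3 s, Fin.sum_univ_eq_sum_range
      (fun s : ℕ => (-1) ^ l.1 * (2 * (if s < k + 1 then 0 else (-1) ^ s) +
          if s = k then (-1) ^ k else 0) : ℕ → ℤ), ← Finset.mul_sum, Finset.sum_add_distrib,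
      ← Finset.mul_sum, h, Finset.sum_ite_eq', if_pos (Finset.mem_range.2 hk)]
    simp only [cancelWeight, leadIndicator]
    ring

/-- The leading term of `δ Y^m`, where `Y` is a sum of terms `y_j t^(j+1)` with the given leading
term. -/
def powLead {n : ℕ} (δ : ℤˣ) (m : ℕ) : LeadTerm n → LeadTerm n
  | none => none
  | some (s, σ) => if h : m * (s + 1) - 1 < n then some (⟨m * (s + 1) - 1, h⟩, δ * σ ^ m) else none

open Classical in
/-- The coefficient of `T^k` in the modified zeta function of sign `τ` of the monomial `δ y^m`. -/
noncomputable def modCoeff (τ δ : ℤˣ) (m k : ℕ) : ℤ :=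
  if m ∣ k then (if Odd m then 0 else if δ = τ then (-1) ^ (k / m + 1) else (-1) ^ (k / m))
  else (-1) ^ (k / m)

/-- Truncation is harmless: a power of order larger than `n` is recorded as `none`, which passes the
test, and by `k < n` its order is indeed larger than `k + 1`. -/
theorem leadIndicator_powLead {n k m : ℕ} (hm : 1 ≤ m) (hk : k < n) (τ δ : ℤˣ) (s : Fin n)
    (σ : ℤˣ) : leadIndicator k τ (powLead δ m (some (s, σ))) =
      if k + 1 < m * (s + 1) ∨ (k + 1 = m * (s + 1) ∧ δ * σ ^ m = τ) then 1 else 0 := by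
  have h1 : 1 ≤ m * (s + 1) := Nat.mul_pos hm (Nat.succ_pos _)
  simp only [powLead]
  generalize m * ((s : ℕ) + 1) = a at h1
  split_ifs with h2 h3 h3
  · simp only [leadIndicator]
    rw [if_pos]
    rcases h3 with h3 | ⟨h3, h4⟩
    · left; omega
    · right; exact ⟨by omega, h4⟩
  · simp only [leadIndicator]
    rw [if_neg]
    rintro (h4 | ⟨h4, h5⟩)
    · exact h3 (Or.inl (by omega))
    · exact h3 (Or.inr ⟨by omega, h5⟩)
  · rfl
  · exfalso; apply h3; left; omega

/-- With `q = (k + 1) / m`, the test forces `q` coordinates of the arc to vanish if `m` does not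
divide `k + 1`. Otherwise it forces `q - 1` of them to vanish and leaves for the next one a closed
half line (`m` odd, Euler characteristic `0`), a line or a point (`m` even). -/
theorem sum_leadWeight_mul_leadIndicator {n k m : ℕ} (hm : 1 ≤ m) (hk : k < n) (τ δ : ℤˣ) :
    ∑ T : LeadTerm n, leadWeight T * leadIndicator k τ (powLead δ m T) =
      (-1) ^ n * modCoeff τ δ m (k + 1) := by
  classical
  set q := (k + 1) / m with hq
  have hqn : q ≤ n := (Nat.div_le_self _ _).trans hk
  have h := two_mul_sum_neg_one_pow hqn
  have hlt : ∀ s : ℕ, k + 1 < m * (s + 1) ↔ ¬ s < q := fun s => by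
    rw [not_lt, hq, ← Nat.lt_succ_iff, Nat.div_lt_iff_lt_mul hm, mul_comm]
  have hnn : ((-1 : ℤ) ^ n) * (-1) ^ n = 1 := by rw [← mul_pow]; simp
  -- `M` counts the signs of the leading coefficient of the arc for which its power has sign `τ`:
  -- one for odd `m`, two or none for even `m`.
  set M : ℤ := (if δ * 1 ^ m = τ then 1 else 0) + (if δ * (-1) ^ m = τ then 1 else 0) with hM
  have h3 : ∀ s : Fin n, leadWeight (some (s, (1 : ℤˣ))) *
        leadIndicator k τ (powLead δ m (some (s, 1))) +
      leadWeight (some (s, (-1 : ℤˣ))) * leadIndicator k τ (powLead δ m (some (s, -1))) =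
        (fun s : ℕ => (-1) ^ n * (2 * (if s < q then 0 else (-1) ^ s) +
          if k + 1 = m * (s + 1) then (-1) ^ s * M else 0)) s := by
    intro s
    simp only [leadIndicator_powLead hm hk, leadWeight, hM]
    have h4 := hlt s
    by_cases h5 : (s : ℕ) < q
    · have h6 : ¬ k + 1 < m * (s + 1) := fun h6 => h4.1 h6 h5
      simp only [h5, if_true, h6, false_or]
      by_cases h7 : k + 1 = m * (s + 1)
      · simp only [h7, true_and, if_true]
        ring
      · simp only [h7, false_and, if_false]
        ring
    · have h6 := h4.2 h5
      have h7 := h6.ne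
      simp only [h5, h6, h7, true_or, if_true, if_false]
      ring
  rw [sum_leadTerm, Finset.sum_congr rfl fun s _ => h3 s, Fin.sum_univ_eq_sum_range
    (fun s : ℕ => (-1) ^ n * (2 * (if s < q then 0 else (-1) ^ s) +
          if k + 1 = m * (s + 1) then (-1) ^ s * M else 0) : ℕ → ℤ), ← Finset.mul_sum,
    Finset.sum_add_distrib, ← Finset.mul_sum, h]
  by_cases hdvd : m ∣ k + 1
  · have hkm : k + 1 = m * q := (Nat.mul_div_cancel' hdvd).symm
    have hq1 : 1 ≤ q := by
      rcases Nat.eq_zero_or_pos q with h0 | h0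
      · rw [h0] at hkm; omega
      · exact h0
    have h4 : ∀ s : ℕ, k + 1 = m * (s + 1) ↔ s = q - 1 := fun s => by
      rw [hkm, Nat.mul_right_inj (by omega)]
      omega
    simp only [h4, Finset.sum_ite_eq', Finset.mem_range]
    rw [if_pos (by omega)]
    have h5 : (-1 : ℤ) ^ q = (-1) ^ (q - 1) * (-1) := by
      rw [← pow_succ]
      congr 1
      omega
    have h6 : leadWeight (none : LeadTerm n) * leadIndicator k τ (powLead δ m (none : LeadTerm n)) = 1 := rfl
    rw [h6, modCoeff, if_pos hdvd, ← hq, pow_succ, h5]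
    split_ifs with h7 h8
    · have : M = 1 := by
        rw [hM, h7.neg_one_pow]
        rcases Int.units_eq_one_or δ with rfl | rfl <;> rcases Int.units_eq_one_or τ with rfl | rfl <;>
          simp
      rw [this]
      linear_combination -hnn
    · have : M = 2 := by
        rw [hM, (Nat.not_odd_iff_even.1 h7).neg_one_pow]
        simp [h8]
      rw [this]
      linear_combination -hnn
    · have : M = 0 := by
        rw [hM, (Nat.not_odd_iff_even.1 h7).neg_one_pow]
        simp [h8]
      rw [this]
      linear_combination -hnn
  · have h4 : ∀ s : ℕ, ¬ k + 1 = m * (s + 1) := fun s hs => hdvd ⟨_, hs⟩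
    simp only [h4, if_false, Finset.sum_const_zero]
    have h6 : leadWeight (none : LeadTerm n) * leadIndicator k τ (powLead δ m (none : LeadTerm n)) = 1 := rfl
    rw [h6, modCoeff, if_neg hdvd, ← hq]
    linear_combination -hnn

/-! ### Composition of Brieskorn polynomials with arcs -/

open Polynomial in
/-- The polynomial `y_0 t + ⋯ + y_(n-1) t^n`, where `y_j = x_(N+j)`. -/
noncomputable def arcPoly (n N : ℕ) (x : ℕ → ℝ) : ℝ[X] :=
  ∑ j ∈ Finset.range n, C (x (N + j)) * X ^ (j + 1)

theorem arcPoly_coeff_zero (n N : ℕ) (x : ℕ → ℝ) : (arcPoly n N x).coeff 0 = 0 := by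
  simp [arcPoly, Polynomial.finsetSum_coeff, Polynomial.coeff_X_pow]

theorem arcPoly_coeff_succ (n N : ℕ) (x : ℕ → ℝ) (j : ℕ) :
    (arcPoly n N x).coeff (j + 1) = if j < n then x (N + j) else 0 := by
  simp [arcPoly, Polynomial.finsetSum_coeff, Polynomial.coeff_X_pow]

/-- All coefficients of the polynomial `P x` are continuous in `x`. -/
def CoeffContinuous (P : (ℕ → ℝ) → Polynomial ℝ) : Prop :=
  ∀ k, Continuous fun x => (P x).coeff k

namespace CoeffContinuous

variable {P Q : (ℕ → ℝ) → Polynomial ℝ}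

theorem const (p : Polynomial ℝ) : CoeffContinuous fun _ => p := fun _ => continuous_const

theorem add (hP : CoeffContinuous P) (hQ : CoeffContinuous Q) :
    CoeffContinuous fun x => P x + Q x := fun k => by
  simp only [Polynomial.coeff_add]
  exact (hP k).add (hQ k)

theorem mul (hP : CoeffContinuous P) (hQ : CoeffContinuous Q) :
    CoeffContinuous fun x => P x * Q x := fun k => by
  simp only [Polynomial.coeff_mul]
  exact continuous_finsetSum _ fun i _ => (hP i.1).mul (hQ i.2)

theorem pow (hP : CoeffContinuous P) (m : ℕ) : CoeffContinuous fun x => P x ^ m := by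
  induction m with
  | zero => simpa only [pow_zero] using const 1
  | succ m ih => simpa only [pow_succ] using ih.mul hP

theorem arcPoly (n N : ℕ) : CoeffContinuous (arcPoly n N) := by
  rintro (_ | j)
  · simpa only [arcPoly_coeff_zero] using continuous_const
  · simp only [arcPoly_coeff_succ]
    split_ifs
    · exact continuous_apply _
    · exact continuous_const

end CoeffContinuous

/-! ### Coefficients of powers of arcs -/

/-- Write `V = W + X^i D`. In the binomial expansion only the linear term contributes at degree `i`,
because the remainder is divisible by `X^(2i)` and `i ≥ 1`. -/
theorem coeff_pow_of_congr {V W : Polynomial ℝ} {i : ℕ} (hi : 1 ≤ i)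
    (h : ∀ j < i, V.coeff j = W.coeff j) (hW : W.coeff i = 0) (m : ℕ) :
    (V ^ m).coeff i = (W ^ m).coeff i + m * V.coeff 0 ^ (m - 1) * V.coeff i := by
  obtain ⟨D, hD⟩ : Polynomial.X ^ i ∣ V - W :=
    Polynomial.X_pow_dvd_iff.2 fun j hj => by rw [Polynomial.coeff_sub, h j hj, sub_self]
  have hD0 : D.coeff 0 = V.coeff i := by
    have := congrArg (fun p => Polynomial.coeff p (0 + i)) hD
    simp only [Polynomial.coeff_X_pow_mul] at this
    rw [← this, Polynomial.coeff_sub, zero_add, hW, sub_zero]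
  obtain ⟨K, hK⟩ := Polynomial.powAddExpansion W (Polynomial.X ^ i * D) m
  rw [← hD, add_sub_cancel, hD] at hK
  have h1 : (K * (Polynomial.X ^ i * D) ^ 2).coeff i = 0 := by
    have : K * (Polynomial.X ^ i * D) ^ 2 = Polynomial.X ^ (2 * i) * (K * D ^ 2) := by ring
    rw [this, Polynomial.coeff_X_pow_mul', if_neg (by omega)]
  have h2 : ((m : Polynomial ℝ) * W ^ (m - 1) * (Polynomial.X ^ i * D)).coeff i =
      m * V.coeff 0 ^ (m - 1) * V.coeff i := by
    have : (m : Polynomial ℝ) * W ^ (m - 1) * (Polynomial.X ^ i * D) =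
      Polynomial.X ^ i * ((m : Polynomial ℝ) * W ^ (m - 1) * D) := by ring
    rw [this]
    have h3 := Polynomial.coeff_X_pow_mul ((m : Polynomial ℝ) * W ^ (m - 1) * D) i 0
    rw [zero_add] at h3
    rw [h3, ← hD0, h 0 hi]
    simp only [Polynomial.coeff_zero_eq_eval_zero, Polynomial.eval_mul, Polynomial.eval_pow,
      Polynomial.eval_natCast]
  rw [hK, Polynomial.coeff_add, Polynomial.coeff_add, h1, h2, add_zero]

/-- Removal of the leading power of `t` from an arc. -/
theorem exists_arcPoly_eq {n N s : ℕ} {x : ℕ → ℝ} (h : ∀ j < s, x (N + j) = 0) :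
    ∃ V : Polynomial ℝ, arcPoly n N x = Polynomial.X ^ (s + 1) * V ∧
      ∀ i, s + i < n → V.coeff i = x (N + s + i) := by
  obtain ⟨V, hV⟩ : Polynomial.X ^ (s + 1) ∣ arcPoly n N x :=
    Polynomial.X_pow_dvd_iff.2 fun j hj => by
      rcases j with _ | j
      · exact arcPoly_coeff_zero n N x
      · rw [arcPoly_coeff_succ, h j (by omega), ite_self]
  refine ⟨V, hV, fun i hi => ?_⟩
  have := arcPoly_coeff_succ n N x (s + i)
  rw [hV, if_pos hi, show s + i + 1 = i + (s + 1) by ring, Polynomial.coeff_X_pow_mul] at this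
  rw [this, add_assoc]

theorem arcPoly_pow_coeff {n N s : ℕ} {x : ℕ → ℝ} (h : ∀ j < s, x (N + j) = 0) (hs : s < n)
    (m : ℕ) : (∀ k < m * (s + 1), (arcPoly n N x ^ m).coeff k = 0) ∧
      (arcPoly n N x ^ m).coeff (m * (s + 1)) = x (N + s) ^ m := by
  obtain ⟨V, hV, hVc⟩ := exists_arcPoly_eq (n := n) h
  rw [hV, mul_pow, ← pow_mul, mul_comm (s + 1) m]
  refine ⟨fun k hk => by rw [Polynomial.coeff_X_pow_mul', if_neg (by omega)], ?_⟩
  have h1 := Polynomial.coeff_X_pow_mul (V ^ m) (m * (s + 1)) 0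
  rw [zero_add] at h1
  rw [h1, Polynomial.coeff_zero_eq_eval_zero, Polynomial.eval_pow,
    ← Polynomial.coeff_zero_eq_eval_zero, hVc 0 (by omega), add_zero]

/-- After division by `t^(s+1)`, the arc and its truncation before the coordinate `s + i` agree
below degree `i`, and the latter has coefficient `0` at `i`. So this coordinate first enters the
power at degree `m (s + 1) + i`, linearly and with slope `m y_s^(m-1)`. -/
theorem arcPoly_pow_coeff_affine {n N s i : ℕ} {x : ℕ → ℝ} (h : ∀ j < s, x (N + j) = 0)
    (hi : 1 ≤ i) (hs : s + i < n) (m : ℕ) :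
    (arcPoly n N x ^ m).coeff (m * (s + 1) + i) =
      (arcPoly n N (truncSeq (N + s + i) x) ^ m).coeff (m * (s + 1) + i) +
        m * x (N + s) ^ (m - 1) * x (N + s + i) := by
  obtain ⟨V, hV, hVc⟩ := exists_arcPoly_eq (n := n) h
  obtain ⟨W, hW, hWc⟩ := exists_arcPoly_eq (n := n) (N := N) (s := s)
    (x := truncSeq (N + s + i) x) fun j hj => by
      rw [truncSeq_apply_of_lt (by omega), h j hj]
  rw [hV, hW, mul_pow, mul_pow, ← pow_mul, mul_comm (s + 1) m, add_comm _ i,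
    Polynomial.coeff_X_pow_mul, Polynomial.coeff_X_pow_mul,
    coeff_pow_of_congr hi (W := W) ?_ ?_, hVc 0 (by omega), hVc i hs, add_zero]
  · intro j hj
    rw [hVc j (by omega), hWc j (by omega), truncSeq_apply_of_lt (by omega)]
  · rw [hWc i hs, truncSeq_apply_of_le le_rfl]

theorem arcPoly_eq_zero {n N : ℕ} {x : ℕ → ℝ} (h : ∀ j < n, x (N + j) = 0) :
    arcPoly n N x = 0 :=
  Finset.sum_eq_zero fun j hj => by rw [h j (Finset.mem_range.1 hj)]; simp

theorem units_mul_self_real (σ : ℤˣ) : ((σ : ℤ) : ℝ) * ((σ : ℤ) : ℝ) = 1 := by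
  rcases Int.units_eq_one_or σ with rfl | rfl <;> simp

theorem units_pow_mul_pow_real (σ : ℤˣ) (m : ℕ) : ((σ : ℤ) : ℝ) ^ m * ((σ : ℤ) : ℝ) ^ m = 1 := by
  rw [← mul_pow, units_mul_self_real, one_pow]

/-- The coefficient of `t^(j+1)` in `δ Y^m`. -/
noncomputable def powCoeff (n N : ℕ) (δ : ℤˣ) (m : ℕ) (x : ℕ → ℝ) (j : ℕ) : ℝ :=
  ((δ : ℤ) : ℝ) * (arcPoly n N x ^ m).coeff (j + 1)

theorem hasLead_powLead {n N m : ℕ} (hm : 1 ≤ m) (δ : ℤˣ) {T : LeadTerm n} {x : ℕ → ℝ}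
    (h : HasLead T fun j => x (N + j)) : HasLead (powLead δ m T) (powCoeff n N δ m x) := by
  rcases T with _ | ⟨s, σ⟩
  · intro j _
    rw [powCoeff, arcPoly_eq_zero h, zero_pow (by omega)]
    simp
  · obtain ⟨h1, h2⟩ := arcPoly_pow_coeff h.1 s.2 m
    have h3 : 1 ≤ m * (s + 1) := Nat.mul_pos hm (Nat.succ_pos _)
    simp only [powLead]
    split_ifs with h4
    · refine ⟨fun j hj => ?_, ?_⟩
      · rw [powCoeff, h1 _ (by simp only at hj; omega), mul_zero]
      · simp only [powCoeff]
        rw [Nat.sub_add_cancel h3, h2, Units.val_mul, Units.val_pow_eq_pow_val, Int.cast_mul,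
          Int.cast_pow]
        have h5 := pow_pos h.2 m
        rw [mul_pow] at h5
        calc (0 : ℝ) < ((σ : ℤ) : ℝ) ^ m * x (N + s) ^ m := h5
          _ = _ := by
            linear_combination (-(((σ : ℤ) : ℝ) ^ m * x (N + s) ^ m)) * units_mul_self_real δ
    · intro j hj
      rw [powCoeff, h1 _ (by omega), mul_zero]

namespace SeqEulerChar

variable {n N : ℕ} {S : Set (ℕ → ℝ)} {c : ℤ}

theorem zeros (h : SeqEulerChar N S c) (i : ℕ) :
    SeqEulerChar (N + i) {x | truncSeq N x ∈ S ∧ ∀ j < i, x (N + j) = 0} c :=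
  h.affine_zero (g := fun j x => x (N + j)) (φ := fun _ _ => 0) (β := fun _ => 1)
    (fun j _ x _ => by simp) (fun _ _ => continuous_const) continuous_const
    fun _ _ => one_ne_zero

theorem lead (h : SeqEulerChar N S c) (T : LeadTerm n) :
    SeqEulerChar (N + n) {x | truncSeq N x ∈ S ∧ HasLead T fun j => x (N + j)}
      (leadWeight T * c) := by
  rcases T with _ | ⟨s, σ⟩
  · rw [leadWeight, one_mul]
    exact h.zeros n
  · have h1 := (h.affine_sign (g := fun j x => x (N + j)) (φ := fun _ _ => 0) (β := fun _ => 1)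
      (i := s) (fun j _ x _ => by simp) (fun _ _ => continuous_const) continuous_const 1
      (by simp) σ).free (n - s - 1)
    rw [show N + s + 1 + (n - s - 1) = N + n by omega] at h1
    convert h1.congr fun x _ => ?_ using 1
    · obtain ⟨k, hk⟩ : ∃ k, n = s + 1 + k := ⟨n - s - 1, by omega⟩
      rw [leadWeight, show n - s - 1 = k by omega, show n + (s : ℕ) = 2 * s + k + 1 by omega,
        pow_succ, pow_add, pow_mul]
      simp
    · simp only [Set.mem_ofPred_eq]
      rw [truncSeq_truncSeq (by omega), truncSeq_apply_of_lt (by omega)]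
      refine and_congr_right fun _ => and_congr_left fun _ => forall₂_congr fun j hj => ?_
      rw [truncSeq_apply_of_lt (by omega)]

end SeqEulerChar

/-! ### Adding one monomial -/

/-- The coefficients of `t, t^2, …` of a polynomial. -/
noncomputable def tailCoeff (p : Polynomial ℝ) (j : ℕ) : ℝ := p.coeff (j + 1)

/-- The polynomial `h + δ Y^m`. -/
noncomputable def addPow (n N : ℕ) (δ : ℤˣ) (m : ℕ) (h : (ℕ → ℝ) → Polynomial ℝ) (x : ℕ → ℝ) :
    Polynomial ℝ :=
  h x + Polynomial.C ((δ : ℤ) : ℝ) * arcPoly n N x ^ m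

theorem tailCoeff_addPow (n N : ℕ) (δ : ℤˣ) (m : ℕ) (h : (ℕ → ℝ) → Polynomial ℝ) (x : ℕ → ℝ)
    (j : ℕ) : tailCoeff (addPow n N δ m h x) j = tailCoeff (h x) j + powCoeff n N δ m x j := by
  simp [tailCoeff, addPow, powCoeff]

theorem CoeffContinuous.addPow {h : (ℕ → ℝ) → Polynomial ℝ} (hh : CoeffContinuous h) (n N : ℕ)
    (δ : ℤˣ) (m : ℕ) : CoeffContinuous (addPow n N δ m h) :=
  hh.add ((CoeffContinuous.const _).mul ((CoeffContinuous.arcPoly n N).pow m))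

namespace SeqEulerChar

variable {n N m : ℕ} {S : Set (ℕ → ℝ)} {c : ℤ} {h : (ℕ → ℝ) → Polynomial ℝ}

/-- The sequences with given leading terms `E` of `h`, `T` of the new arc and `G` of the sum. -/
def leadSet (n N : ℕ) (δ : ℤˣ) (m : ℕ) (h : (ℕ → ℝ) → Polynomial ℝ) (E T G : LeadTerm n) :
    Set (ℕ → ℝ) :=
  {x | HasLead E (tailCoeff (h x)) ∧ HasLead T (fun j => x (N + j)) ∧
    HasLead G (tailCoeff (addPow n N δ m h x))}

/-- The leading term of the sum is forced, so the weight is concentrated at a single `G`. -/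
theorem leadSet_of_not_cancels (hm : 1 ≤ m) (hh : ∀ x, h (truncSeq N x) = h x) (δ : ℤˣ)
    {E T : LeadTerm n} (hE : SeqEulerChar N {x | HasLead E (tailCoeff (h x))} c)
    (hET : ¬ Cancels E (powLead δ m T)) :
    ∃ w : LeadTerm n → ℤ,
      (∀ G, SeqEulerChar (N + n) (leadSet n N δ m h E T G) (leadWeight T * c * w G)) ∧
      ∑ G, w G = 1 ∧ ∀ k τ, ∑ G, w G * leadIndicator k τ G =
        leadIndicator k τ E * leadIndicator k τ (powLead δ m T) := by
  classical
  obtain ⟨G₀, h1, h2⟩ := exists_hasLead_add hET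
  refine ⟨fun G => if G = G₀ then 1 else 0, fun G => ?_, by simp, fun k τ => ?_⟩
  · have key : ∀ x, HasLead E (tailCoeff (h x)) → HasLead T (fun j => x (N + j)) →
        HasLead G₀ (tailCoeff (addPow n N δ m h x)) := fun x hx hy => by
      simpa only [← tailCoeff_addPow] using h1 _ _ hx (hasLead_powLead hm δ hy)
    simp only
    split_ifs with hG
    · subst hG
      rw [mul_one]
      refine (hE.lead T).congr fun x _ => ?_
      simp only [Set.mem_ofPred_eq, hh, leadSet]
      exact ⟨fun ⟨hx, hy⟩ => ⟨hx, hy, key x hx hy⟩, fun ⟨hx, hy, _⟩ => ⟨hx, hy⟩⟩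
    · rw [mul_zero]
      refine SeqEulerChar.empty.congr fun x _ => ?_
      simp only [Set.mem_empty_iff_false, false_iff]
      exact fun ⟨hx, hy, hz⟩ => hG (hz.unique (key x hx hy))
  · simp [h2]

/-- The situation in which the leading terms may cancel. -/
structure CancelData (n N m : ℕ) (h : (ℕ → ℝ) → Polynomial ℝ) (δ : ℤˣ) (l s : Fin n) (τ σ : ℤˣ) :
    Prop where
  pos : 1 ≤ m
  trunc : ∀ x, h (truncSeq N x) = h x
  cont : CoeffContinuous h
  index : m * (s + 1) = l + 1
  sign : δ * σ ^ m = -τ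

namespace CancelData

variable {δ : ℤˣ} {l s : Fin n} {τ σ : ℤˣ}

/-- The absolute value of the `y_s` for which the leading terms cancel. -/
noncomputable def root (m : ℕ) (h : (ℕ → ℝ) → Polynomial ℝ) (l : Fin n) (x : ℕ → ℝ) : ℝ :=
  |tailCoeff (h x) l| ^ (m : ℝ)⁻¹

theorem trunc_le (d : CancelData n N m h δ l s τ σ) {K : ℕ} (hK : N ≤ K) (x : ℕ → ℝ) :
    h (truncSeq K x) = h x := by
  rw [← d.trunc, truncSeq_truncSeq hK, d.trunc]

theorem le (d : CancelData n N m h δ l s τ σ) : (s : ℕ) ≤ l := by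
  have h1 := d.index
  have := Nat.le_mul_of_pos_left (s + 1 : ℕ) d.pos
  omega

theorem continuous_root (d : CancelData n N m h δ l s τ σ) : Continuous (root m h l) :=
  (d.cont _).abs.rpow_const fun _ => Or.inr (by positivity)

theorem root_pos {x : ℕ → ℝ} (hx : HasLead (some (l, τ)) (tailCoeff (h x))) : 0 < root m h l x :=
  Real.rpow_pos_of_pos (abs_pos.2 (ne_zero_of_units_mul_pos hx.2)) _

theorem root_pow (d : CancelData n N m h δ l s τ σ) {x : ℕ → ℝ}
    (hx : HasLead (some (l, τ)) (tailCoeff (h x))) :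
    root m h l x ^ m = ((τ : ℤ) : ℝ) * tailCoeff (h x) l := by
  have h1 := d.pos
  rw [root, Real.rpow_inv_natCast_pow (abs_nonneg _) (by omega)]
  have h2 := hx.2
  rw [← abs_of_pos h2, abs_mul]
  rcases Int.units_eq_one_or τ with rfl | rfl <;> simp

theorem tailCoeff_addPow_of_lt (d : CancelData n N m h δ l s τ σ) {x : ℕ → ℝ}
    (hx : HasLead (some (l, τ)) (tailCoeff (h x))) (hy : ∀ j < (s : ℕ), x (N + j) = 0)
    {j : ℕ} (hj : j < l) : tailCoeff (addPow n N δ m h x) j = 0 := by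
  have h1 := d.index
  rw [tailCoeff_addPow, hx.1 j hj, powCoeff, (arcPoly_pow_coeff hy s.2 m).1 _ (by omega)]
  simp

/-- Since `δ σ^m = -τ`, the two contributions at index `l` have opposite signs, and comparing them
amounts to comparing `σ y_s` with the root. -/
theorem sign_mul_tailCoeff (d : CancelData n N m h δ l s τ σ) {x : ℕ → ℝ}
    (hx : HasLead (some (l, τ)) (tailCoeff (h x))) (hy : ∀ j < (s : ℕ), x (N + j) = 0) :
    ((τ : ℤ) : ℝ) * tailCoeff (addPow n N δ m h x) l =
      root m h l x ^ m - (((σ : ℤ) : ℝ) * x (N + s)) ^ m := by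
  have h1 := congrArg (fun u : ℤˣ => ((u : ℤ) : ℝ)) d.sign
  simp only [Units.val_mul, Units.val_pow_eq_pow_val, Units.val_neg, Int.cast_mul, Int.cast_pow,
    Int.cast_neg] at h1
  rw [tailCoeff_addPow, powCoeff, ← d.index, (arcPoly_pow_coeff hy s.2 m).2, mul_add,
    d.root_pow hx, mul_pow]
  have h2 := units_mul_self_real τ
  have h3 := units_pow_mul_pow_real σ m
  linear_combination (((τ : ℤ) : ℝ) * ((σ : ℤ) : ℝ) ^ m * x (N + s) ^ m) * h1 -
    (((τ : ℤ) : ℝ) * ((δ : ℤ) : ℝ) * x (N + s) ^ m) * h3 -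
    (((σ : ℤ) : ℝ) ^ m * x (N + s) ^ m) * h2

theorem tailCoeff_addPow_affine (d : CancelData n N m h δ l s τ σ) {x : ℕ → ℝ}
    (hy : ∀ j < (s : ℕ), x (N + j) = 0) {j : ℕ} (hj : l + 1 + j < n) :
    tailCoeff (addPow n N δ m h x) (l + 1 + j) =
      tailCoeff (addPow n N δ m h (truncSeq (N + s + 1 + j) x)) (l + 1 + j) +
        (((δ : ℤ) : ℝ) * m * x (N + s) ^ (m - 1)) * x (N + s + 1 + j) := by
  have h1 := d.index
  have h2 := d.le
  have h3 := arcPoly_pow_coeff_affine (n := n) (i := 1 + j) hy (by omega) (by omega) m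
  rw [h1, ← add_assoc, ← add_assoc] at h3
  rw [tailCoeff_addPow, tailCoeff_addPow, d.trunc_le (by omega), powCoeff, powCoeff,
    show (l + 1 + j + 1 : ℕ) = l + 1 + 1 + j by omega, h3]
  ring

/-- The set of the pairs of `h` and `y_0, …, y_s` for which the leading terms cancel. -/
theorem cancelSet (d : CancelData n N m h δ l s τ σ)
    (hE : SeqEulerChar N {x | HasLead (some (l, τ)) (tailCoeff (h x))} c) :
    SeqEulerChar (N + s + 1) {x | HasLead (some (l, τ)) (tailCoeff (h x)) ∧
      (∀ j < (s : ℕ), x (N + j) = 0) ∧ ((σ : ℤ) : ℝ) * x (N + s) = root m h l x} c := by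
  refine ((hE.zeros s).graph (φ := fun x => ((σ : ℤ) : ℝ) * root m h l x)
    (continuous_const.mul d.continuous_root).continuousOn).congr fun x _ => ?_
  simp only [Set.mem_ofPred_eq, root, d.trunc_le le_rfl, d.trunc_le (Nat.le_add_right N s)]
  rw [and_assoc]
  refine and_congr_right fun _ => and_congr (forall₂_congr fun j hj => ?_) ?_
  · rw [truncSeq_apply_of_lt (by omega)]
  · have h2 := units_mul_self_real σ
    constructor
    · intro h3
      rw [h3, ← mul_assoc, h2, one_mul]
    · intro h3
      rw [← h3, ← mul_assoc, h2, one_mul]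

/-- Vanishing at index `l` means that `σ y_s` equals the root, as `m`-th powers are injective on
nonnegative reals. `P` stands for the conditions on the later coefficients. -/
theorem hasLead_iff_of_cancel (d : CancelData n N m h δ l s τ σ) (x : ℕ → ℝ) (P : Prop)
    {G : LeadTerm n} (hG : HasLead G (tailCoeff (addPow n N δ m h x)) ↔
      tailCoeff (addPow n N δ m h x) l = 0 ∧ P) :
    x ∈ leadSet n N δ m h (some (l, τ)) (some (s, σ)) G ↔
      (HasLead (some (l, τ)) (tailCoeff (h x)) ∧
      (∀ j < (s : ℕ), x (N + j) = 0) ∧ ((σ : ℤ) : ℝ) * x (N + s) = root m h l x) ∧ P := by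
  have hm : m ≠ 0 := by have := d.pos; omega
  simp only [leadSet, Set.mem_ofPred_eq, hG]
  constructor
  · rintro ⟨hx, hy, h0, hP⟩
    have h1 := d.sign_mul_tailCoeff hx hy.1
    rw [h0, mul_zero, eq_comm, sub_eq_zero] at h1
    exact ⟨⟨hx, hy.1, ((pow_left_inj₀ (root_pos hx).le hy.2.le hm).1 h1).symm⟩, hP⟩
  · rintro ⟨⟨hx, hy, h1⟩, hP⟩
    refine ⟨hx, ⟨hy, ?_⟩, ?_, hP⟩
    · simp only [h1]
      exact root_pos hx
    · have h2 := d.sign_mul_tailCoeff hx hy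
      rw [h1, sub_self] at h2
      by_contra h3
      rcases mul_eq_zero.1 h2 with h4 | h4
      · rcases Int.units_eq_one_or τ with rfl | rfl <;> simp at h4
      · exact h3 h4

theorem hasLead_none_iff {l : Fin n} {δ : ℤˣ} {x : ℕ → ℝ} (h0 : ∀ j < (l : ℕ), tailCoeff (addPow n N δ m h x) j = 0) :
    HasLead (none : LeadTerm n) (tailCoeff (addPow n N δ m h x)) ↔
      tailCoeff (addPow n N δ m h x) l = 0 ∧
        ∀ j < n - 1 - l, tailCoeff (addPow n N δ m h x) (l + 1 + j) = 0 := by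
  constructor
  · exact fun h1 => ⟨h1 l l.2, fun j hj => h1 _ (by omega)⟩
  · rintro ⟨h1, h2⟩ j hj
    rcases lt_trichotomy j l with hjl | rfl | hjl
    · exact h0 j hjl
    · exact h1
    · have := h2 (j - l - 1) (by omega)
      rwa [show l + 1 + (j - l - 1) = j by omega] at this

theorem hasLead_some_iff {l k : Fin n} {δ : ℤˣ} {x : ℕ → ℝ} (hlk : (l : ℕ) < k) (υ : ℤˣ)
    (h0 : ∀ j < (l : ℕ), tailCoeff (addPow n N δ m h x) j = 0) :
    HasLead (some (k, υ)) (tailCoeff (addPow n N δ m h x)) ↔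
      tailCoeff (addPow n N δ m h x) l = 0 ∧
        (∀ j < (k - l - 1 : ℕ), tailCoeff (addPow n N δ m h x) (l + 1 + j) = 0) ∧
        0 < ((υ : ℤ) : ℝ) * tailCoeff (addPow n N δ m h x) (l + 1 + (k - l - 1)) := by
  rw [show (l + 1 + (k - l - 1) : ℕ) = k by omega]
  constructor
  · exact fun h1 => ⟨h1.1 l hlk, fun j hj => h1.1 _ (by omega), h1.2⟩
  · rintro ⟨h1, h2, h3⟩
    refine ⟨fun j hj => ?_, h3⟩
    rcases lt_trichotomy j l with hjl | rfl | hjl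
    · exact h0 j hjl
    · exact h1
    · have := h2 (j - l - 1) (by omega)
      rwa [show l + 1 + (j - l - 1) = j by omega] at this

/-- By the affine formula, `y_(s+1+j)` is the last coordinate on which this coefficient depends. -/
theorem tailCoeff_addPow_trunc (d : CancelData n N m h δ l s τ σ) {x : ℕ → ℝ}
    (hy : ∀ j < (s : ℕ), x (N + j) = 0) {j K : ℕ} (hj : l + 1 + j < n)
    (hK : N + s + 1 + j < K) :
    tailCoeff (addPow n N δ m h (truncSeq K x)) (l + 1 + j) =
      tailCoeff (addPow n N δ m h x) (l + 1 + j) := by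
  have hy' : ∀ j < (s : ℕ), truncSeq K x (N + j) = 0 := fun j hj => by
    rw [truncSeq_apply_of_lt (by omega), hy j hj]
  rw [d.tailCoeff_addPow_affine hy hj, d.tailCoeff_addPow_affine hy' hj,
    truncSeq_truncSeq (by omega), truncSeq_apply_of_lt (by omega), truncSeq_apply_of_lt (by omega)]

theorem mem_cancelSet_trunc (d : CancelData n N m h δ l s τ σ) {K : ℕ} (hK : N + s + 1 ≤ K)
    (x : ℕ → ℝ) :
    truncSeq K x ∈ {x | HasLead (some (l, τ)) (tailCoeff (h x)) ∧
      (∀ j < (s : ℕ), x (N + j) = 0) ∧ ((σ : ℤ) : ℝ) * x (N + s) = root m h l x} ↔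
    HasLead (some (l, τ)) (tailCoeff (h x)) ∧
      (∀ j < (s : ℕ), x (N + j) = 0) ∧ ((σ : ℤ) : ℝ) * x (N + s) = root m h l x := by
  simp only [Set.mem_ofPred_eq, root, d.trunc_le (show N ≤ K by omega)]
  rw [truncSeq_apply_of_lt (show N + s < K by omega)]
  refine and_congr_right fun _ => and_congr_left fun _ => forall₂_congr fun j hj => ?_
  rw [truncSeq_apply_of_lt (by omega)]

theorem leadSet_none (d : CancelData n N m h δ l s τ σ)
    (hE : SeqEulerChar N {x | HasLead (some (l, τ)) (tailCoeff (h x))} c) :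
    SeqEulerChar (N + n) (leadSet n N δ m h (some (l, τ)) (some (s, σ)) none)
      ((-1) ^ (l - s : ℕ) * c) := by
  have hsl := d.le
  -- Each of the `n - 1 - l` coefficients after the index `l` is killed by one new coordinate
  -- `y_(s+1+j)`; the last `l - s` coordinates affect none of them and are free.
  have h1 := ((d.cancelSet hE).affine_zero
    (g := fun j x => tailCoeff (addPow n N δ m h x) (l + 1 + j))
    (φ := fun j x => tailCoeff (addPow n N δ m h x) (l + 1 + j))
    (β := fun x => ((δ : ℤ) : ℝ) * m * x (N + s) ^ (m - 1)) (i := n - 1 - l) ?_ ?_ ?_ ?_).free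
    (l - s)
  · rw [show N + s + 1 + (n - 1 - l) + (l - s) = N + n by omega] at h1
    refine h1.congr fun x _ => ?_
    have hS := d.mem_cancelSet_trunc le_rfl x
    rw [Set.mem_ofPred_eq, Set.mem_ofPred_eq, truncSeq_truncSeq (by omega), hS]
    by_cases hy : HasLead (some (l, τ)) (tailCoeff (h x)) ∧ ∀ j < (s : ℕ), x (N + j) = 0
    · rw [d.hasLead_iff_of_cancel x _ (hasLead_none_iff fun j hj =>
        d.tailCoeff_addPow_of_lt hy.1 hy.2 hj)]
      refine and_congr_right fun _ => forall₂_congr fun j hj => ?_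
      rw [d.tailCoeff_addPow_trunc hy.2 (by omega) (by omega)]
    · exact ⟨fun h2 => absurd ⟨h2.1.1, h2.1.2.1⟩ hy, fun h2 => absurd ⟨h2.1, h2.2.1.1⟩ hy⟩
  · intro j hj x hx
    have hy := (d.mem_cancelSet_trunc le_rfl x).1 hx
    rw [d.tailCoeff_addPow_affine hy.2.1 (by omega), truncSeq_apply_of_lt (by omega)]
  · exact fun j _ => d.cont.addPow n N δ m _
  · exact continuous_const.mul ((continuous_apply _).pow _)
  · rintro x ⟨hx, _, h2⟩
    have h3 : x (N + s) ≠ 0 := ne_zero_of_units_mul_pos (h2 ▸ root_pos hx)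
    have h4 : (m : ℝ) ≠ 0 := by have := d.pos; positivity
    have h5 : ((δ : ℤ) : ℝ) ≠ 0 := by simp
    positivity

theorem leadSet_some (d : CancelData n N m h δ l s τ σ)
    (hE : SeqEulerChar N {x | HasLead (some (l, τ)) (tailCoeff (h x))} c) {k : Fin n}
    (hlk : (l : ℕ) < k) (υ : ℤˣ) :
    SeqEulerChar (N + n) (leadSet n N δ m h (some (l, τ)) (some (s, σ)) (some (k, υ)))
      ((-1) ^ (n - s - 1 - (k - l) : ℕ) * -c) := by
  have hsl := d.le
  -- After the root come `k - l - 1` graphs, one half line for the sign at `k`, and free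
  -- coordinates. The slope has sign `δ σ^(m-1)` because `σ y_s > 0`.
  have h1 := ((d.cancelSet hE).affine_sign
    (g := fun j x => tailCoeff (addPow n N δ m h x) (l + 1 + j))
    (φ := fun j x => tailCoeff (addPow n N δ m h x) (l + 1 + j))
    (β := fun x => ((δ : ℤ) : ℝ) * m * x (N + s) ^ (m - 1)) (i := k - l - 1) ?_ ?_ ?_
    (δ * σ ^ (m - 1)) ?_ υ).free (n - s - 1 - (k - l))
  · rw [show N + s + 1 + (k - l - 1) + 1 + (n - s - 1 - (k - l)) = N + n by omega] at h1
    refine h1.congr fun x _ => ?_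
    have hS := d.mem_cancelSet_trunc le_rfl x
    rw [Set.mem_ofPred_eq, Set.mem_ofPred_eq, truncSeq_truncSeq (by omega), hS]
    by_cases hy : HasLead (some (l, τ)) (tailCoeff (h x)) ∧ ∀ j < (s : ℕ), x (N + j) = 0
    · rw [d.hasLead_iff_of_cancel x _ (hasLead_some_iff hlk υ fun j hj =>
        d.tailCoeff_addPow_of_lt hy.1 hy.2 hj)]
      refine and_congr_right fun _ => and_congr (forall₂_congr fun j hj => ?_) ?_
      · rw [d.tailCoeff_addPow_trunc hy.2 (by omega) (by omega)]
      · rw [d.tailCoeff_addPow_trunc hy.2 (by omega) (by omega)]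
    · exact ⟨fun h2 => absurd ⟨h2.1.1, h2.1.2.1⟩ hy, fun h2 => absurd ⟨h2.1, h2.2.1.1⟩ hy⟩
  · intro j hj x hx
    have hy := (d.mem_cancelSet_trunc le_rfl x).1 hx
    rw [d.tailCoeff_addPow_affine hy.2.1 (by omega), truncSeq_apply_of_lt (by omega)]
  · exact fun j _ => d.cont.addPow n N δ m _
  · exact continuous_const.mul ((continuous_apply _).pow _)
  · rintro x ⟨hx, _, h2⟩
    have h3 : 0 < ((σ : ℤ) : ℝ) * x (N + s) := h2 ▸ root_pos hx
    have h4 : (0 : ℝ) < m := by have := d.pos; positivity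
    calc (0 : ℝ) < m * (((σ : ℤ) : ℝ) * x (N + s)) ^ (m - 1) := by positivity
      _ = _ := by
        rw [Units.val_mul, Units.val_pow_eq_pow_val, Int.cast_mul, Int.cast_pow, mul_pow]
        linear_combination (-(m * ((σ : ℤ) : ℝ) ^ (m - 1) * x (N + s) ^ (m - 1))) *
          units_mul_self_real δ

/-- The term of `h` dominates when `σ y_s` lies strictly between `0` and the root: an open segment,
followed by free coordinates. -/
theorem leadSet_same (d : CancelData n N m h δ l s τ σ)
    (hE : SeqEulerChar N {x | HasLead (some (l, τ)) (tailCoeff (h x))} c) :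
    SeqEulerChar (N + n) (leadSet n N δ m h (some (l, τ)) (some (s, σ)) (some (l, τ)))
      ((-1) ^ (n - s - 1 : ℕ) * -c) := by
  have hm : m ≠ 0 := by have := d.pos; omega
  have h1 := ((hE.zeros s).segment (d.continuous_root.continuousOn) (fun x hx => ?_) σ).free
    (n - s - 1)
  · rw [show N + s + 1 + (n - s - 1) = N + n by omega] at h1
    refine h1.congr fun x _ => ?_
    simp only [leadSet, Set.mem_ofPred_eq, root, d.trunc_le le_rfl,
      d.trunc_le (show N ≤ N + s by omega), d.trunc_le (show N ≤ N + s + 1 by omega)]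
    rw [truncSeq_apply_of_lt (show N + s < N + s + 1 by omega), and_assoc]
    refine and_congr_right fun hx => ?_
    have h2 : (∀ j < (s : ℕ), truncSeq (N + s) (truncSeq (N + s + 1) x) (N + j) = 0) ↔
        ∀ j < (s : ℕ), x (N + j) = 0 := forall₂_congr fun j hj => by
      rw [truncSeq_apply_of_lt (by omega), truncSeq_apply_of_lt (by omega)]
    rw [h2]
    constructor
    · rintro ⟨hy, h3, h4⟩
      refine ⟨⟨hy, h3⟩, fun j hj => d.tailCoeff_addPow_of_lt hx hy hj, ?_⟩
      rw [d.sign_mul_tailCoeff hx hy, sub_pos]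
      exact pow_lt_pow_left₀ h4 h3.le hm
    · rintro ⟨⟨hy, h3⟩, _, h4⟩
      rw [d.sign_mul_tailCoeff hx hy, sub_pos] at h4
      exact ⟨hy, h3, lt_of_pow_lt_pow_left₀ m (root_pos hx).le h4⟩
  · rw [Set.mem_ofPred_eq, Set.mem_ofPred_eq, d.trunc] at hx
    exact root_pos hx.1

/-- The new monomial dominates when `σ y_s` lies beyond the root: an open half line, followed by
free coordinates. -/
theorem leadSet_opposite (d : CancelData n N m h δ l s τ σ)
    (hE : SeqEulerChar N {x | HasLead (some (l, τ)) (tailCoeff (h x))} c) :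
    SeqEulerChar (N + n) (leadSet n N δ m h (some (l, τ)) (some (s, σ)) (some (l, -τ)))
      ((-1) ^ (n - s - 1 : ℕ) * -c) := by
  have hm : m ≠ 0 := by have := d.pos; omega
  have h1 := ((hE.zeros s).halfLine (φ := fun x => ((σ : ℤ) : ℝ) * root m h l x)
    (continuous_const.mul d.continuous_root).continuousOn σ).free (n - s - 1)
  rw [show N + s + 1 + (n - s - 1) = N + n by omega] at h1
  refine h1.congr fun x _ => ?_
  simp only [leadSet, Set.mem_ofPred_eq, root, d.trunc_le le_rfl,
    d.trunc_le (show N ≤ N + s by omega), d.trunc_le (show N ≤ N + s + 1 by omega)]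
  rw [truncSeq_apply_of_lt (show N + s < N + s + 1 by omega), and_assoc]
  refine and_congr_right fun hx => ?_
  have h2 : (∀ j < (s : ℕ), truncSeq (N + s) (truncSeq (N + s + 1) x) (N + j) = 0) ↔
      ∀ j < (s : ℕ), x (N + j) = 0 := forall₂_congr fun j hj => by
    rw [truncSeq_apply_of_lt (by omega), truncSeq_apply_of_lt (by omega)]
  have hr : 0 < root m h l x := root_pos hx
  rw [h2, mul_sub, ← mul_assoc, units_mul_self_real, one_mul, sub_pos]
  change _ ∧ root m h l x < _ ↔ _
  have h5 : ((-τ : ℤˣ) : ℤ) = -(τ : ℤ) := Units.val_neg τ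
  constructor
  · rintro ⟨hy, h4⟩
    refine ⟨⟨hy, hr.trans h4⟩, fun j hj => d.tailCoeff_addPow_of_lt hx hy hj, ?_⟩
    rw [h5, Int.cast_neg, neg_mul, d.sign_mul_tailCoeff hx hy, neg_sub, sub_pos]
    exact pow_lt_pow_left₀ h4 hr.le hm
  · rintro ⟨⟨hy, h3⟩, _, h4⟩
    rw [h5, Int.cast_neg, neg_mul, d.sign_mul_tailCoeff hx hy, neg_sub, sub_pos] at h4
    exact ⟨hy, lt_of_pow_lt_pow_left₀ m h3.le h4⟩

theorem leadSet_cancelWeight (d : CancelData n N m h δ l s τ σ)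
    (hE : SeqEulerChar N {x | HasLead (some (l, τ)) (tailCoeff (h x))} c) (G : LeadTerm n) :
    SeqEulerChar (N + n) (leadSet n N δ m h (some (l, τ)) (some (s, σ)) G)
      (leadWeight (some (s, σ)) * c * cancelWeight l G) := by
  have hsl := d.le
  obtain ⟨p, hp⟩ : ∃ p, (l : ℕ) = s + p := ⟨l - s, by omega⟩
  obtain ⟨q, hq⟩ : ∃ q, n = l + 1 + q := ⟨n - l - 1, by omega⟩
  have hone : ∀ a : ℕ, (-1 : ℤ) ^ (2 * a) = 1 := fun a => by simp [pow_mul]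
  rcases G with _ | ⟨k, υ⟩
  · convert d.leadSet_none hE using 1
    rw [leadWeight, cancelWeight, mul_right_comm, ← pow_add]
    congr 1
    rw [show n + s + (n + l) = 2 * (n + s) + (l - s) by omega, pow_add, hone, one_mul]
  · rcases lt_trichotomy (k : ℕ) l with hkl | hkl | hkl
    · rw [cancelWeight, if_pos hkl, mul_zero]
      refine SeqEulerChar.empty.congr fun x _ => ?_
      simp only [Set.mem_empty_iff_false, false_iff]
      rintro ⟨hx, hy, hz⟩
      exact ne_zero_of_units_mul_pos hz.2 (d.tailCoeff_addPow_of_lt hx hy.1 hkl)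
    · obtain rfl : k = l := Fin.ext hkl
      have h1 : (-1 : ℤ) ^ (n - s - 1) * -c =
          leadWeight (some (s, σ)) * c * cancelWeight k (some (k, υ)) := by
        rw [cancelWeight, if_neg (lt_irrefl _), ← two_mul, hone, leadWeight,
          show n + s = 2 * s + (n - s - 1) + 1 by omega, pow_succ, pow_add, hone]
        ring
      rw [← h1]
      by_cases hυ : υ = τ
      · subst hυ
        exact d.leadSet_same hE
      · obtain rfl : υ = -τ := by
          rcases Int.units_eq_one_or τ with rfl | rfl <;>
            rcases Int.units_eq_one_or υ with rfl | rfl <;> simp at hυ ⊢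
        exact d.leadSet_opposite hE
    · convert d.leadSet_some hE hkl υ using 1
      rw [leadWeight, cancelWeight, if_neg (by omega), mul_right_comm, ← pow_add,
        show n + s + (k + l) = 2 * (s + k) + (n - s - 1 - (k - l)) + 1 by omega, pow_succ,
        pow_add, hone]
      ring

end CancelData

/-- The leading terms of `h + δ Y^m` are distributed multiplicatively. -/
theorem exists_leadSet (hm : 1 ≤ m) (hh : ∀ x, h (truncSeq N x) = h x) (hc : CoeffContinuous h)
    (δ : ℤˣ) {E : LeadTerm n} (T : LeadTerm n)
    (hE : SeqEulerChar N {x | HasLead E (tailCoeff (h x))} c) :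
    ∃ w : LeadTerm n → ℤ,
      (∀ G, SeqEulerChar (N + n) (leadSet n N δ m h E T G) (leadWeight T * c * w G)) ∧
      ∑ G, w G = 1 ∧ ∀ k < n, ∀ τ, ∑ G, w G * leadIndicator k τ G =
        leadIndicator k τ E * leadIndicator k τ (powLead δ m T) := by
  by_cases hET : Cancels E (powLead δ m T)
  · obtain ⟨l, τ, rfl, hF⟩ := hET
    rcases T with _ | ⟨s, σ⟩
    · simp [powLead] at hF
    · have d : CancelData n N m h δ l s τ σ := by
        have h1 : 1 ≤ m * (s + 1) := Nat.mul_pos hm (Nat.succ_pos _)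
        simp only [powLead] at hF
        split_ifs at hF with h2
        simp only [Option.some.injEq, Prod.mk.injEq] at hF
        have h3 := congrArg Fin.val hF.1
        simp only at h3
        exact ⟨hm, hh, hc, by omega, hF.2⟩
      refine ⟨cancelWeight l, d.leadSet_cancelWeight hE, sum_cancelWeight l.2.le,
        fun k hk υ => ?_⟩
      rw [hF]
      exact sum_cancelWeight_mul_leadIndicator hk l τ υ
  · obtain ⟨w, h1, h2, h3⟩ := leadSet_of_not_cancels hm hh δ hE hET
    exact ⟨w, h1, h2, fun k _ τ => h3 k τ⟩

/-- Stratify by the leading terms `E` of `h` and `T` of the new arc. The relative weights integrate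
to `1` and integrate the indicator to a product, so the double sum splits into a sum over `E` and a
sum over `T`; the latter is the contribution of the monomial. -/
theorem exists_addPow (hm : 1 ≤ m) (hh : ∀ x, h (truncSeq N x) = h x) (hc : CoeffContinuous h)
    (δ : ℤˣ) {e : LeadTerm n → ℤ}
    (hE : ∀ E : LeadTerm n, SeqEulerChar N {x | HasLead E (tailCoeff (h x))} (e E)) :
    ∃ e' : LeadTerm n → ℤ,
      (∀ G : LeadTerm n, SeqEulerChar (N + n)
        {x | HasLead G (tailCoeff (addPow n N δ m h x))} (e' G)) ∧
      ∑ G, e' G = (-1) ^ n * ∑ E, e E ∧ ∀ k < n, ∀ τ, ∑ G, e' G * leadIndicator k τ G =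
        (-1) ^ n * modCoeff τ δ m (k + 1) * ∑ E, e E * leadIndicator k τ E := by
  choose w h1 h2 h3 using fun E T => exists_leadSet hm hh hc δ T (hE E)
  refine ⟨fun G => ∑ p : LeadTerm n × LeadTerm n, leadWeight p.2 * e p.1 * w p.1 p.2 G,
    fun G => ?_, ?_, fun k hk τ => ?_⟩
  · refine SeqEulerChar.sum (fun p x => HasLead p.1 (tailCoeff (h x)) ∧
      HasLead p.2 fun j => x (N + j)) (fun x _ => ?_) fun p => (h1 p.1 p.2 G).congr fun x _ => ?_
    · obtain ⟨E, hE1, hE2⟩ := existsUnique_hasLead n (tailCoeff (h x))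
      obtain ⟨T, hT1, hT2⟩ := existsUnique_hasLead n fun j => x (N + j)
      exact ⟨(E, T), ⟨hE1, hT1⟩, fun p hp => Prod.ext (hE2 _ hp.1) (hT2 _ hp.2)⟩
    · simp only [leadSet, Set.mem_ofPred_eq]
      tauto
  · rw [Finset.sum_comm]
    simp only [← Finset.mul_sum, h2, mul_one]
    rw [Fintype.sum_prod_type, ← sum_leadWeight n, Finset.sum_mul_sum, Finset.sum_comm]
  · simp only [Finset.sum_mul]
    rw [Finset.sum_comm]
    simp only [mul_assoc, ← Finset.mul_sum, h3 _ _ k hk τ]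
    rw [← mul_assoc, ← sum_leadWeight_mul_leadIndicator hm hk, Fintype.sum_prod_type,
      Finset.sum_mul_sum, Finset.sum_comm]
    refine Finset.sum_congr rfl fun T _ => Finset.sum_congr rfl fun E _ => ?_
    ring

end SeqEulerChar

/-! ### The zeta functions of Brieskorn polynomials -/

/-- The value of a Brieskorn polynomial in `d` variables at the arc with coefficients `x`. -/
noncomputable def brieskornArc (n : ℕ) (ε : ℕ → ℤˣ) (m : ℕ → ℕ) : ℕ → (ℕ → ℝ) → Polynomial ℝ
  | 0 => fun _ => 0
  | d + 1 => addPow n (d * n) (ε d) (m d) (brieskornArc n ε m d)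

theorem coeffContinuous_brieskornArc (n : ℕ) (ε : ℕ → ℤˣ) (m : ℕ → ℕ) (d : ℕ) :
    CoeffContinuous (brieskornArc n ε m d) := by
  induction d with
  | zero => exact CoeffContinuous.const 0
  | succ d ih => exact ih.addPow _ _ _ _

theorem arcPoly_truncSeq {n N K : ℕ} (h : N + n ≤ K) (x : ℕ → ℝ) :
    arcPoly n N (truncSeq K x) = arcPoly n N x := by
  refine Finset.sum_congr rfl fun j hj => ?_
  have := Finset.mem_range.1 hj
  rw [truncSeq_apply_of_lt (by omega)]

theorem brieskornArc_truncSeq (n : ℕ) (ε : ℕ → ℤˣ) (m : ℕ → ℕ) {d K : ℕ} (hK : d * n ≤ K)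
    (x : ℕ → ℝ) : brieskornArc n ε m d (truncSeq K x) = brieskornArc n ε m d x := by
  induction d with
  | zero => rfl
  | succ d ih =>
    rw [Nat.succ_mul] at hK
    simp only [brieskornArc, addPow, ih (by omega), arcPoly_truncSeq hK]

theorem exists_leadEulerChar (n : ℕ) (ε : ℕ → ℤˣ) (m : ℕ → ℕ) (d : ℕ) (hm : ∀ i < d, 1 ≤ m i) :
    ∃ e : LeadTerm n → ℤ,
      (∀ E : LeadTerm n, SeqEulerChar (d * n)
        {x | HasLead E (tailCoeff (brieskornArc n ε m d x))} (e E)) ∧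
      ∑ E, e E = ((-1) ^ n) ^ d ∧ ∀ k < n, ∀ τ, ∑ E, e E * leadIndicator k τ E =
        ((-1) ^ n) ^ d * ∏ i ∈ Finset.range d, modCoeff τ (ε i) (m i) (k + 1) := by
  classical
  induction d with
  | zero =>
    refine ⟨fun E => if E = none then 1 else 0, fun E => ?_, by simp, fun k _ τ => ?_⟩
    · have key : ∀ x, HasLead (none : LeadTerm n) (tailCoeff (brieskornArc n ε m 0 x)) :=
        fun x j _ => by simp [tailCoeff, brieskornArc]
      rw [Nat.zero_mul]
      simp only
      split_ifs with hE
      · subst hE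
        exact SeqEulerChar.zero_univ.congr fun x _ => by simp [key x]
      · refine SeqEulerChar.empty.congr fun x _ => ?_
        simp only [Set.mem_empty_iff_false, false_iff]
        exact fun hx => hE (hx.unique (key x))
    · simp [leadIndicator]
  | succ d ih =>
    obtain ⟨e, h1, h2, h3⟩ := ih fun i hi => hm i (by omega)
    obtain ⟨e', h1', h2', h3'⟩ := SeqEulerChar.exists_addPow (hm d (by omega))
      (brieskornArc_truncSeq n ε m le_rfl) (coeffContinuous_brieskornArc n ε m d) (ε d) h1
    refine ⟨e', fun E => ?_, ?_, fun k hk τ => ?_⟩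
    · rw [Nat.succ_mul]
      exact h1' E
    · rw [h2', h2, pow_succ']
    · rw [h3' k hk, h3 k hk, Finset.prod_range_succ]
      ring

/-- The Euler characteristic of the arcs along which the order is larger than `k`, computed from the
coefficients `A` of the modified zeta functions of sign `1` and `-1`. -/
def orderChar (A : ℤˣ → ℕ → ℤ) : ℕ → ℤ
  | 0 => 1
  | k + 1 => A 1 (k + 1) + A (-1) (k + 1) - orderChar A k

/-- The indicator of the leading terms of index at least `k`. -/
def orderIndicator {n : ℕ} (k : ℕ) : LeadTerm n → ℤ
  | none => 1
  | some (s, _) => if k ≤ s then 1 else 0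

/-- Leading index `k` and sign `τ` means: index at least `k`, but coefficient at `k` neither zero
nor of sign `-τ`. Index `k` belongs to `t^(k+1)`, hence the shift in `A`. -/
theorem eulerChar_eq_orderChar_sub {n : ℕ} {e : LeadTerm n → ℤ} {A : ℤˣ → ℕ → ℤ} {u : ℤ}
    (h0 : ∑ E, e E = u)
    (h : ∀ k < n, ∀ τ, ∑ E, e E * leadIndicator k τ E = u * A τ (k + 1)) (k : Fin n) (τ : ℤˣ) :
    e (some (k, τ)) = u * (orderChar A k - A (-τ) (k + 1)) := by
  classical
  have h1 : ∀ k ≤ n, ∑ E, e E * orderIndicator k E = u * orderChar A k := by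
    intro k hk
    induction k with
    | zero =>
      rw [orderChar, mul_one, ← h0]
      refine Finset.sum_congr rfl fun E _ => ?_
      rcases E with _ | ⟨s, σ⟩ <;> simp [orderIndicator]
    | succ k ih =>
      rw [orderChar, mul_sub, mul_add, ← h k hk, ← h k hk, ← ih (by omega),
        ← Finset.sum_add_distrib, ← Finset.sum_sub_distrib]
      refine Finset.sum_congr rfl fun E _ => ?_
      rw [← mul_add, ← mul_sub]
      congr 1
      rcases E with _ | ⟨s, σ⟩
      · simp [orderIndicator, leadIndicator]
      · simp only [orderIndicator, leadIndicator]
        rcases lt_trichotomy k s with hks | hks | hks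
        · rw [if_pos (by omega), if_pos (Or.inl hks), if_pos (Or.inl hks), if_pos hks.le]
          rfl
        · rw [if_neg (by omega), if_pos hks.le]
          rcases Int.units_eq_one_or σ with rfl | rfl
          · rw [if_pos (Or.inr ⟨hks, rfl⟩), if_neg]
            · rfl
            · rintro (h | ⟨_, h⟩)
              · omega
              · exact absurd h (by decide)
          · have h2 : ¬ (k < (s : ℕ) ∨ k = s ∧ (-1 : ℤˣ) = 1) := by
              rintro (h | ⟨_, h⟩)
              · omega
              · exact absurd h (by decide)
            rw [if_neg h2, if_pos (Or.inr ⟨hks, rfl⟩)]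
            rfl
        · rw [if_neg (by omega), if_neg (by omega), if_neg (by omega), if_neg (by omega)]
          rfl
  rw [mul_sub, ← h1 k k.2.le, ← h k k.2, ← Finset.sum_sub_distrib]
  have h2 : ∀ E : LeadTerm n, e E * orderIndicator k E - e E * leadIndicator k (-τ) E =
      if E = some (k, τ) then e E else 0 := by
    rintro (_ | ⟨s, σ⟩)
    · simp [orderIndicator, leadIndicator]
    · simp only [orderIndicator, leadIndicator, Option.some.injEq, Prod.mk.injEq]
      rcases lt_trichotomy (k : ℕ) s with hks | hks | hks
      · rw [if_pos hks.le, if_pos (Or.inl hks), if_neg fun h => by rw [h.1] at hks; omega]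
        ring
      · obtain rfl : k = s := Fin.ext hks
        rcases Int.units_eq_one_or σ with rfl | rfl <;>
          rcases Int.units_eq_one_or τ with rfl | rfl <;> simp
      · rw [if_neg (by omega), if_neg (by omega), if_neg fun h => by rw [h.1] at hks; omega]
        ring
  rw [Finset.sum_congr rfl fun E _ => h2 E, Finset.sum_ite_eq', if_pos (Finset.mem_univ _)]

/-! ### From Landau symbols to leading coefficients -/

theorem eval_isBigO_pow_iff (q : Polynomial ℝ) (k : ℕ) :
    (fun t : ℝ => q.eval t) =O[𝓝 0] (fun t : ℝ => t ^ k) ↔ Polynomial.X ^ k ∣ q := by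
  constructor
  · intro h
    by_contra hk
    have hq : q ≠ 0 := by
      rintro rfl
      exact hk (dvd_zero _)
    obtain ⟨r, hr, hr0⟩ := q.exists_eq_pow_rootMultiplicity_mul_and_not_dvd hq 0
    set j := q.rootMultiplicity 0
    rw [Polynomial.C_0, sub_zero] at hr hr0
    have hjk : j < k := by
      by_contra! hkj
      exact hk (hr ▸ (pow_dvd_pow _ hkj).mul_right r)
    -- Dividing by `t^j` requires the punctured neighbourhood; there the cofactor `r` would tend to
    -- `0`, although `X` does not divide it.
    have h1 : (fun t : ℝ => r.eval t) =O[𝓝[≠] 0] (fun t : ℝ => t ^ (k - j)) := by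
      have h2 := (h.mono (nhdsWithin_le_nhds (s := {0}ᶜ))).mul
        (isBigO_refl (fun t : ℝ => (t ^ j)⁻¹) (𝓝[≠] 0))
      refine h2.congr' ?_ ?_ <;> filter_upwards [self_mem_nhdsWithin] with t ht <;>
        have ht' : t ≠ 0 := ht
      · rw [hr, Polynomial.eval_mul, Polynomial.eval_pow, Polynomial.eval_X]
        field_simp
      · rw [pow_sub₀ t ht' hjk.le]
    have h3 : Tendsto (fun t : ℝ => t ^ (k - j)) (𝓝[≠] 0) (𝓝 0) := by
      have : Continuous fun t : ℝ => t ^ (k - j) := by fun_prop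
      have := this.tendsto 0
      rw [zero_pow (by omega)] at this
      exact this.mono_left nhdsWithin_le_nhds
    have h4 := h1.trans_tendsto h3
    have h5 : Tendsto (fun t : ℝ => r.eval t) (𝓝[≠] 0) (𝓝 (r.eval 0)) :=
      (r.continuous.tendsto 0).mono_left nhdsWithin_le_nhds
    exact hr0 (Polynomial.X_dvd_iff.2
      (by rw [Polynomial.coeff_zero_eq_eval_zero, tendsto_nhds_unique h5 h4]))
  · rintro ⟨r, rfl⟩
    have h1 : (fun t : ℝ => r.eval t) =O[𝓝 0] (fun _ => (1 : ℝ)) :=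
      (r.continuous.tendsto 0).isBigO_one ℝ
    simpa using (isBigO_refl (fun t : ℝ => t ^ k) (𝓝 0)).mul h1

theorem exists_isBigO_iff_hasLead {p : Polynomial ℝ} (hp : p.coeff 0 = 0) {n : ℕ}
    (k : Fin n) (σ : ℤˣ) :
    (∃ c : ℝ, 0 < ((σ : ℤ) : ℝ) * c ∧ (fun t : ℝ => p.eval t - c * t ^ (k + 1 : ℕ)) =O[𝓝 0]
      (fun t : ℝ => t ^ (k + 1 + 1 : ℕ))) ↔ HasLead (some (k, σ)) (tailCoeff p) := by
  have h1 : ∀ c : ℝ, ((fun t : ℝ => p.eval t - c * t ^ (k + 1 : ℕ)) =O[𝓝 0]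
      (fun t : ℝ => t ^ (k + 1 + 1 : ℕ))) ↔
      ∀ j < (k + 1 + 1 : ℕ), p.coeff j = if j = k + 1 then c else 0 := by
    intro c
    have h2 := eval_isBigO_pow_iff (p - Polynomial.C c * Polynomial.X ^ (k + 1 : ℕ)) (k + 1 + 1)
    simp only [Polynomial.eval_sub, Polynomial.eval_mul, Polynomial.eval_C, Polynomial.eval_pow,
      Polynomial.eval_X, Polynomial.X_pow_dvd_iff, Polynomial.coeff_sub,
      Polynomial.coeff_C_mul_X_pow, sub_eq_zero] at h2
    exact h2
  simp only [h1]
  constructor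
  · rintro ⟨c, hc, h2⟩
    refine ⟨fun j hj => ?_, ?_⟩
    · rw [tailCoeff, h2 _ (by omega), if_neg (by omega)]
    · rwa [tailCoeff, h2 _ (by omega), if_pos rfl]
  · rintro ⟨h2, h3⟩
    refine ⟨p.coeff (k + 1), h3, fun j hj => ?_⟩
    split_ifs with hjk
    · rw [hjk]
    · rcases j with _ | j
      · exact hp
      · exact h2 j (by omega)

theorem brieskornArc_coeff_zero {n : ℕ} {ε : ℕ → ℤˣ} {m : ℕ → ℕ} {d : ℕ}
    (hm : ∀ i < d, 1 ≤ m i) (x : ℕ → ℝ) : (brieskornArc n ε m d x).coeff 0 = 0 := by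
  induction d with
  | zero => simp [brieskornArc]
  | succ d ih =>
    have h1 := hm d (by omega)
    have h2 : (arcPoly n (d * n) x ^ m d).coeff 0 = 0 := by
      rw [Polynomial.coeff_zero_eq_eval_zero, Polynomial.eval_pow,
        ← Polynomial.coeff_zero_eq_eval_zero, arcPoly_coeff_zero, zero_pow (by omega)]
    rw [brieskornArc, addPow, Polynomial.coeff_add, Polynomial.coeff_C_mul, h2, mul_zero, add_zero]
    exact ih fun i hi => hm i (by omega)

/-- The extension of a finite family by a constant. -/
def extendFin {α : Type*} {d : ℕ} (a : α) (f : Fin d → α) (i : ℕ) : α :=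
  if h : i < d then f ⟨i, h⟩ else a

theorem extendFin_coe {α : Type*} {d : ℕ} (a : α) (f : Fin d → α) (i : Fin d) :
    extendFin a f i = f i := by
  simp [extendFin]

theorem eval_brieskornArc {n d : ℕ} (ε : Fin d → ℤˣ) (m : Fin d → ℕ) (a : Fin (d * n) → ℝ)
    (t : ℝ) : (brieskornArc n (extendFin 1 ε) (extendFin 1 m) d (extendZero a)).eval t =
      brieskorn ε m (truncArc a t) := by
  have h1 : ∀ (ε : ℕ → ℤˣ) (m : ℕ → ℕ) (d : ℕ) (x : ℕ → ℝ),
      (brieskornArc n ε m d x).eval t = ∑ i ∈ Finset.range d,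
        (((ε i : ℤˣ) : ℤ) : ℝ) * (arcPoly n (i * n) x).eval t ^ m i := by
    intro ε m d x
    induction d with
    | zero => simp [brieskornArc]
    | succ d ih => simp [brieskornArc, addPow, ih, Finset.sum_range_succ]
  rw [h1, ← Fin.sum_univ_eq_sum_range (fun i => (((extendFin 1 ε i : ℤˣ) : ℤ) : ℝ) *
    (arcPoly n (i * n) (extendZero a)).eval t ^ extendFin 1 m i), brieskorn]
  refine Finset.sum_congr rfl fun i _ => ?_
  rw [extendFin_coe, extendFin_coe]
  congr 2
  rw [arcPoly, Polynomial.eval_finsetSum, truncArc, Finset.sum_range]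
  refine Finset.sum_congr rfl fun k _ => ?_
  simp only [Polynomial.eval_mul, Polynomial.eval_C, Polynomial.eval_pow, Polynomial.eval_X]
  congr 1
  have h2 : (i : ℕ) * n + k = (finProdFinEquiv (i, k) : Fin (d * n)) := by
    rw [finProdFinEquiv_apply_val]
    ring
  rw [h2, extendZero, dif_pos (finProdFinEquiv (i, k)).2]

/-- The coefficient of `T^k` in the modified zeta function of sign `τ` of a Brieskorn
polynomial. -/
noncomputable def modProd {d : ℕ} (ε : Fin d → ℤˣ) (m : Fin d → ℕ) (τ : ℤˣ) (k : ℕ) : ℤ :=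
  ∏ i, modCoeff τ (ε i) (m i) k

theorem hasEulerChar_arcs {d n : ℕ} (ε : Fin d → ℤˣ) (m : Fin d → ℕ) (hm : ∀ i, 1 ≤ m i)
    (k : Fin n) (σ : ℤˣ) :
    HasEulerChar {a : Fin (d * n) → ℝ | ∃ c : ℝ, 0 < ((σ : ℤ) : ℝ) * c ∧
      (fun t : ℝ => brieskorn ε m (truncArc a t) - c * t ^ (k + 1 : ℕ)) =O[𝓝 0]
        (fun t : ℝ => t ^ (k + 1 + 1 : ℕ))}
      (((-1) ^ n) ^ d * (orderChar (modProd ε m) k - modProd ε m (-σ) (k + 1))) := by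
  have hm' : ∀ i < d, 1 ≤ extendFin 1 m i := fun i hi => by
    rw [extendFin, dif_pos hi]
    exact hm _
  obtain ⟨e, h1, h2, h3⟩ := exists_leadEulerChar n (extendFin 1 ε) (extendFin 1 m) d hm'
  have h4 := eulerChar_eq_orderChar_sub (A := modProd ε m) h2 (fun k hk τ => by
    rw [h3 k hk, modProd, ← Fin.prod_univ_eq_prod_range
      (fun i => modCoeff τ (extendFin 1 ε i) (extendFin 1 m i) (k + 1))]
    simp only [extendFin_coe]) k σ
  rw [← h4]
  have h5 := h1 (some (k, σ))
  unfold SeqEulerChar at h5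
  convert h5 using 1
  ext a
  simp only [Set.mem_ofPred_eq]
  rw [← exists_isBigO_iff_hasLead (brieskornArc_coeff_zero hm' _)]
  simp only [eval_brieskornArc]

theorem coeff_zetaPos_brieskorn {d : ℕ} (ε : Fin d → ℤˣ) (m : Fin d → ℕ) (hm : ∀ i, 1 ≤ m i)
    (k : ℕ) : PowerSeries.coeff (k + 1) (zetaPos (brieskorn ε m)) =
      orderChar (modProd ε m) k - modProd ε m (-1) (k + 1) := by
  -- Arcs of length exactly `k + 1` put the leading coefficient at the last index. The sign in the
  -- zeta function cancels the normalization.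
  have h := (hasEulerChar_arcs ε m hm (Fin.last k) 1).eulerCharC_eq
  simp only [Units.val_one, Int.cast_one, one_mul, Fin.val_last] at h
  rw [zetaPos, PowerSeries.coeff_mk, if_neg (Nat.succ_ne_zero k), arcsPos, h, ← mul_assoc, pow_mul,
    ← mul_pow, ← mul_pow]
  simp

theorem coeff_zetaNeg_brieskorn {d : ℕ} (ε : Fin d → ℤˣ) (m : Fin d → ℕ) (hm : ∀ i, 1 ≤ m i)
    (k : ℕ) : PowerSeries.coeff (k + 1) (zetaNeg (brieskorn ε m)) =
      orderChar (modProd ε m) k - modProd ε m 1 (k + 1) := by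
  have h := (hasEulerChar_arcs ε m hm (Fin.last k) (-1)).eulerCharC_eq
  simp only [Units.val_neg, Units.val_one, Int.cast_neg, Int.cast_one, neg_one_mul, Left.neg_pos_iff,
    Fin.val_last, neg_neg] at h
  rw [zetaNeg, PowerSeries.coeff_mk, if_neg (Nat.succ_ne_zero k), arcsNeg, h, ← mul_assoc, pow_mul,
    ← mul_pow, ← mul_pow]
  simp

theorem modProd_eq_of_zeta_eq {d₁ d₂ : ℕ} {ε₁ : Fin d₁ → ℤˣ} {m₁ : Fin d₁ → ℕ}
    {ε₂ : Fin d₂ → ℤˣ} {m₂ : Fin d₂ → ℕ} (hm₁ : ∀ i, 1 ≤ m₁ i) (hm₂ : ∀ i, 1 ≤ m₂ i)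
    (hpos : zetaPos (brieskorn ε₁ m₁) = zetaPos (brieskorn ε₂ m₂))
    (hneg : zetaNeg (brieskorn ε₁ m₁) = zetaNeg (brieskorn ε₂ m₂)) (τ : ℤˣ) {k : ℕ}
    (hk : 1 ≤ k) : modProd ε₁ m₁ τ k = modProd ε₂ m₂ τ k := by
  have hp : ∀ k, orderChar (modProd ε₁ m₁) k - modProd ε₁ m₁ (-1) (k + 1) =
      orderChar (modProd ε₂ m₂) k - modProd ε₂ m₂ (-1) (k + 1) := fun k => by
    rw [← coeff_zetaPos_brieskorn ε₁ m₁ hm₁, ← coeff_zetaPos_brieskorn ε₂ m₂ hm₂, hpos]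
  have hn : ∀ k, orderChar (modProd ε₁ m₁) k - modProd ε₁ m₁ 1 (k + 1) =
      orderChar (modProd ε₂ m₂) k - modProd ε₂ m₂ 1 (k + 1) := fun k => by
    rw [← coeff_zetaNeg_brieskorn ε₁ m₁ hm₁, ← coeff_zetaNeg_brieskorn ε₂ m₂ hm₂, hneg]
  have ho : ∀ k, orderChar (modProd ε₁ m₁) k = orderChar (modProd ε₂ m₂) k := by
    intro k
    induction k with
    | zero => rfl
    | succ k ih =>
      simp only [orderChar]
      linarith [hp k, hn k]
  obtain ⟨k, rfl⟩ : ∃ j, k = j + 1 := ⟨k - 1, by omega⟩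
  rcases Int.units_eq_one_or τ with rfl | rfl
  · linarith [hn k, ho k]
  · linarith [hp k, ho k]

theorem tsSum_brieskorn_signedPower {d : ℕ} (ε : Fin d → ℤˣ) (m : Fin d → ℕ) (δ : ℤˣ) (r : ℕ) :
    tsSum (brieskorn ε m) (signedPower δ r) =
      brieskorn (Fin.snoc (α := fun _ => ℤˣ) ε δ) (Fin.snoc (α := fun _ => ℕ) m r) := by
  funext z
  simp only [tsSum, brieskorn, signedPower, Fin.sum_univ_castSucc, Fin.snoc_castSucc,
    Fin.snoc_last]
  rfl

theorem modProd_snoc {d : ℕ} (ε : Fin d → ℤˣ) (m : Fin d → ℕ) (δ : ℤˣ) (r : ℕ) (τ : ℤˣ) (k : ℕ) :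
    modProd (Fin.snoc (α := fun _ => ℤˣ) ε δ) (Fin.snoc (α := fun _ => ℕ) m r) τ k =
      modProd ε m τ k * modCoeff τ δ r k := by
  simp [modProd, Fin.prod_univ_castSucc]

/-! ### Determination of the exponent -/

theorem modCoeff_ne_zero {τ δ : ℤˣ} {m k : ℕ} (h : Odd m → ¬ m ∣ k) : modCoeff τ δ m k ≠ 0 := by
  unfold modCoeff
  split_ifs with h1 h2
  · exact absurd h1 (h h2)
  all_goals exact pow_ne_zero _ (by norm_num)

theorem modProd_ne_zero {d : ℕ} {ε : Fin d → ℤˣ} {m : Fin d → ℕ} {k : ℕ}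
    (h : ∀ i, Odd (m i) → ¬ m i ∣ k) (τ : ℤˣ) : modProd ε m τ k ≠ 0 :=
  Finset.prod_ne_zero_iff.2 fun i _ => modCoeff_ne_zero (h i)

/-- If `m` does not divide `k`, both signs give the same value `±1`. If it does, the values are both
`0` (`m` odd) or opposite units (`m` even). -/
theorem dvd_iff_modCoeff_mul_ne_one (δ : ℤˣ) (m k : ℕ) :
    m ∣ k ↔ modCoeff 1 δ m k * modCoeff (-1) δ m k ≠ 1 := by
  have h : ∀ a : ℕ, (-1 : ℤ) ^ a * (-1) ^ a = 1 := fun a => by rw [← mul_pow]; simp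
  unfold modCoeff
  split_ifs with h1 h2 h3 h4 h4
  · simp [h1]
  · exact absurd (h3.symm.trans h4) (by decide)
  · simp [h1, pow_succ, h]
  · simp [h1, pow_succ, h]
  · rcases Int.units_eq_one_or δ with rfl | rfl
    · exact absurd rfl h3
    · exact absurd rfl h4
  · simp [h1, h]

/-- Half of `⌊2^(t+1) / r⌋`, rounded down, is `⌊2^t / r⌋`. So the parities recover all these
quotients, starting from `⌊1 / r⌋ = 0`, and the quotients determine `r`. -/
theorem eq_of_two_pow_div_parity {r₁ r₂ : ℕ} (h₁ : 2 ≤ r₁) (h₂ : 2 ≤ r₂)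
    (h : ∀ t : ℕ, (-1 : ℤ) ^ (2 ^ t / r₁) = (-1) ^ (2 ^ t / r₂)) : r₁ = r₂ := by
  have key : ∀ t : ℕ, 2 ^ t / r₁ = 2 ^ t / r₂ := by
    intro t
    induction t with
    | zero => rw [pow_zero, Nat.div_eq_of_lt (by omega), Nat.div_eq_of_lt (by omega)]
    | succ t ih =>
      have h3 : ∀ r, 2 ^ (t + 1) / r / 2 = 2 ^ t / r := fun r => by
        rw [Nat.div_div_eq_div_mul, mul_comm r 2, ← Nat.div_div_eq_div_mul, pow_succ,
          Nat.mul_div_cancel _ two_pos]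
      have h4 := h3 r₁
      have h5 := h3 r₂
      have h6 : 2 ^ (t + 1) / r₁ % 2 = 2 ^ (t + 1) / r₂ % 2 := by
        have h7 := h (t + 1)
        rcases Nat.even_or_odd (2 ^ (t + 1) / r₁) with ha | ha <;>
          rcases Nat.even_or_odd (2 ^ (t + 1) / r₂) with hb | hb <;>
          rw [ha.neg_one_pow, hb.neg_one_pow] at h7
        · rw [Nat.even_iff.1 ha, Nat.even_iff.1 hb]
        · norm_num at h7
        · norm_num at h7
        · rw [Nat.odd_iff.1 ha, Nat.odd_iff.1 hb]
      omega
  have hle : ∀ r₁ r₂ : ℕ, 2 ≤ r₁ → 2 ≤ r₂ → (∀ t : ℕ, 2 ^ t / r₁ = 2 ^ t / r₂) → r₂ ≤ r₁ := by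
    intro r₁ r₂ h₁ h₂ key
    by_contra! hlt
    -- Any power of `2` above `r₁ r₂` would do: a common quotient `q` with `q r₂ ≤ Q < (q + 1) r₁`
    -- and `r₁ < r₂` forces `q < r₁`, so `Q < r₁ r₂`.
    have h3 := key (r₁ * r₂)
    have h4 : r₁ * r₂ < 2 ^ (r₁ * r₂) := Nat.lt_two_pow_self
    have h5 := Nat.div_mul_le_self (2 ^ (r₁ * r₂)) r₂
    have h6 := Nat.lt_div_mul_add (a := 2 ^ (r₁ * r₂)) (b := r₁) (by omega)
    rw [← h3] at h5
    generalize 2 ^ (r₁ * r₂) / r₁ = q at h5 h6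
    generalize 2 ^ (r₁ * r₂) = Q at h4 h5 h6
    have h7 : q < r₁ := by nlinarith
    nlinarith
  exact le_antisymm (hle r₂ r₁ h₂ h₁ fun t => (key t).symm) (hle r₁ r₂ h₁ h₂ key)

theorem exponent_eq_of_modCoeff_eq {ι : Type*} {m : ι → ℕ} (hm : ∀ i, 2 ≤ m i) {δ₁ δ₂ : ℤˣ}
    {r₁ r₂ : ℕ} (hr₁ : 1 ≤ r₁) (hr₂ : 1 ≤ r₂)
    (h : ∀ k, 1 ≤ k → (∀ i, Odd (m i) → ¬ m i ∣ k) →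
      ∀ τ, modCoeff τ δ₁ r₁ k = modCoeff τ δ₂ r₂ k) : r₁ = r₂ := by
  have hdvd : ∀ k, 1 ≤ k → (∀ i, Odd (m i) → ¬ m i ∣ k) → (r₁ ∣ k ↔ r₂ ∣ k) := fun k hk hg => by
    rw [dvd_iff_modCoeff_mul_ne_one δ₁, dvd_iff_modCoeff_mul_ne_one δ₂, h k hk hg, h k hk hg]
  by_cases h1 : ∀ i, Odd (m i) → ¬ m i ∣ r₁
  · have h2 : r₂ ∣ r₁ := (hdvd r₁ hr₁ h1).1 dvd_rfl
    exact Nat.dvd_antisymm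
      ((hdvd r₂ hr₂ fun i hi hd => h1 i hi (hd.trans h2)).2 dvd_rfl) h2
  by_cases h2 : ∀ i, Odd (m i) → ¬ m i ∣ r₂
  · have h3 : r₁ ∣ r₂ := (hdvd r₂ hr₂ h2).2 dvd_rfl
    exact absurd (fun i hi hd => h2 i hi (hd.trans h3)) h1
  -- Now each exponent has some odd `m i > 1` as a divisor, so neither divides a power of `2` and
  -- the coefficients at `2^t` show only the parity of the quotient.
  have hpow : ∀ t i, Odd (m i) → ¬ m i ∣ 2 ^ t := fun t i hi hd => by
    have h3 := Nat.Coprime.eq_one_of_dvd ((Nat.coprime_two_right.2 hi).pow_right t) hd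
    have := hm i
    omega
  push Not at h1 h2
  obtain ⟨i, hi, hir⟩ := h1
  obtain ⟨j, hj, hjr⟩ := h2
  refine eq_of_two_pow_div_parity ((hm i).trans (Nat.le_of_dvd hr₁ hir))
    ((hm j).trans (Nat.le_of_dvd hr₂ hjr)) fun t => ?_
  have h3 := h (2 ^ t) Nat.one_le_two_pow (hpow t) 1
  rwa [modCoeff, modCoeff, if_neg fun hd => hpow t i hi (hir.trans hd),
    if_neg fun hd => hpow t j hj (hjr.trans hd)] at h3

theorem mainTheorem9 {d₁ d₂ : ℕ}
    (ε₁ : Fin d₁ → ℤˣ) (m₁ : Fin d₁ → ℕ) (hm₁ : ∀ i, 2 ≤ m₁ i)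
    (ε₂ : Fin d₂ → ℤˣ) (m₂ : Fin d₂ → ℕ) (hm₂ : ∀ i, 2 ≤ m₂ i)
    (δ₁ δ₂ : ℤˣ) (r₁ r₂ : ℕ) (hr₁ : 1 ≤ r₁) (hr₂ : 1 ≤ r₂)
    (hfpos : zetaPos (brieskorn ε₁ m₁) = zetaPos (brieskorn ε₂ m₂))
    (hfneg : zetaNeg (brieskorn ε₁ m₁) = zetaNeg (brieskorn ε₂ m₂))
    (hfgpos : zetaPos (tsSum (brieskorn ε₁ m₁) (signedPower δ₁ r₁)) =
      zetaPos (tsSum (brieskorn ε₂ m₂) (signedPower δ₂ r₂)))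
    (hfgneg : zetaNeg (tsSum (brieskorn ε₁ m₁) (signedPower δ₁ r₁)) =
      zetaNeg (tsSum (brieskorn ε₂ m₂) (signedPower δ₂ r₂))) :
    r₁ = r₂ ∧
      (Even r₁ → (∀ i, Odd (m₁ i) → ¬ m₁ i ∣ r₁) → δ₁ = δ₂) := by
  have hsnoc : ∀ {d : ℕ} (m : Fin d → ℕ) (r : ℕ), (∀ i, 2 ≤ m i) → 1 ≤ r →
      ∀ i, 1 ≤ (Fin.snoc (α := fun _ => ℕ) m r : Fin (d + 1) → ℕ) i := fun m r hm hr i => by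
    refine Fin.lastCases ?_ (fun i => ?_) i
    · simpa using hr
    · simpa using one_le_two.trans (hm i)
  simp only [tsSum_brieskorn_signedPower] at hfgpos hfgneg
  have hf := modProd_eq_of_zeta_eq (fun i => one_le_two.trans (hm₁ i))
    (fun i => one_le_two.trans (hm₂ i)) hfpos hfneg
  have hfg := modProd_eq_of_zeta_eq (hsnoc m₁ r₁ hm₁ hr₁) (hsnoc m₂ r₂ hm₂ hr₂) hfgpos hfgneg
  -- Only the exponents of `f₁` matter here: the factor of `f₂` is the same integer, and its
  -- nonvanishing allows cancellation.
  have h : ∀ k, 1 ≤ k → (∀ i, Odd (m₁ i) → ¬ m₁ i ∣ k) →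
      ∀ τ, modCoeff τ δ₁ r₁ k = modCoeff τ δ₂ r₂ k := fun k hk hg τ => by
    have h1 := hfg τ hk
    rw [modProd_snoc, modProd_snoc, ← hf τ hk] at h1
    exact mul_left_cancel₀ (modProd_ne_zero hg τ) h1
  obtain rfl := exponent_eq_of_modCoeff_eq hm₁ hr₁ hr₂ h
  refine ⟨rfl, fun hev hg => ?_⟩
  -- For even `r₁`, the coefficient of sign `1` at `k = r₁` is `1` if `δ = 1` and `-1` otherwise.
  have h1 := h r₁ hr₁ hg 1
  have h2 : r₁ / r₁ = 1 := Nat.div_self hr₁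
  simp only [modCoeff, dvd_refl, if_true, Nat.not_odd_iff_even.2 hev, if_false, h2] at h1
  rcases Int.units_eq_one_or δ₁ with rfl | rfl <;> rcases Int.units_eq_one_or δ₂ with rfl | rfl
  · rfl
  · simp at h1
  · simp at h1
  · rfl
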